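/- Let $k \ge 1$ and let $\alpha = (\alpha_1, \dots, \alpha_r)$ be a sequence of integers with $1 \le \alpha_i \le k$ and $\alpha_1 + \cdots + \alpha_r = n$. For $1 \le i \le r$, the $i$-th batch of $[n] = \{1, \dots, n\}$ is $\{\alpha_1 + \cdots + \alpha_{i-1} + 1, \dots, \alpha_1 + \cdots + \alpha_{i-1} + \alpha_i\}$, and $\mathfrak{S}_\alpha = \mathfrak{S}_{\alpha_1} \times \cdots \times \mathfrak{S}_{\alpha_r} \subseteq \mathfrak{S}_n$ is the group of permutations preserving every batch. Let $\mathbf{x}_n = (x_1, \dots, x_n)$ and let $\mathbf{x}_n^{(i)}$ be the variables indexed by the $i$-th batch. Let $J_{\alpha,k} \subseteq \mathbb{Q}[\mathbf{x}_n]$ be the ideal generated by the elementary symmetric polynomials $e_d(\mathbf{x}_n)$ for $n-k+1 \le d \le n$, $d \ge 0$, and the complete homogeneous symmetric polynomials $h_d(\mathbf{x}_n^{(i)})$ for $1 \le i \le r$ and $k - \alpha_i + 1 \le d \le k$. Put $S_{\alpha,k} = \mathbb{Q}[\mathbf{x}_n]/J_{\alpha,k}$, on which $\mathfrak{S}_\alpha$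 acts by permuting the variables. Order the monomials by $\mathtt{neglex}$: $x_1^{a_1} \cdots x_n^{a_n} < x_1^{b_1} \cdots x_n^{b_n}$ if there is $i$ with $a_i < b_i$ and $a_j = b_j$ for all $j > i$. The standard monomials of $S_{\alpha,k}$ are the monomials outside the initial ideal $\langle \mathrm{in}_<(f) : f \in J_{\alpha,k} \setminus \{0\} \rangle$. For $S = \{s_1 < \cdots < s_t\} \subseteq [n]$ define $\gamma(S) = (\gamma_1, \dots, \gamma_n)$ by $\gamma_i = i - j + 1$ if $i = s_j$ and $\gamma_i = 0$ if $i \notin S$, and let $\mathbf{x}(S)^* = x_1^{\gamma_n} \cdots x_n^{\gamma_1}$. Let $\mathcal{M}_{\alpha,k}$ be the set of $\alpha$-nonskip monomials, that is, the monomials $m$ such that $\mathbf{x}(S)^* \nmid m$ for all $S \subseteq [n]$ with $|S| = n-k+1$, and $x_{\alpha_1 + \cdots + \alpha_{i-1} + j}^{k-j+1} \nmid m$ for all $1 \le i \le r$ and $1 \le j \le \alpha_i$. Let $\mathcal{OP}_{\alpha,k}$ be the set of sequences $(B_1 \mid \cdots \mid B_k)$ of nonempty pairwise disjoint subsets of $[n]$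 with union $[n]$ such that for each $i$ the letters of the $i$-th batch lie in distinct blocks; $\mathfrak{S}_\alpha$ acts on it by permuting letters. For distinct rational numbers $\eta_1, \dots, \eta_k$ let $Z_{\alpha,k} \subseteq \mathbb{Q}^n$ be the set of points $(z_1, \dots, z_n)$ with $\{z_1, \dots, z_n\} = \{\eta_1, \dots, \eta_k\}$ such that for each $i$ the coordinates in the $i$-th batch are distinct. For $Z \subseteq \mathbb{Q}^n$ let $\mathbf{T}(Z)$ be the ideal generated by the top-degree homogeneous components of all nonzero polynomials in $\mathbb{Q}[\mathbf{x}_n]$ vanishing on $Z$. **Theorem.** 1. If $k \le n+1$, then $\mathcal{M}_{\alpha,k}$ is the set of standard monomials of $S_{\alpha,k}$ with respect to $\mathtt{neglex}$, and the images of the monomials in $\mathcal{M}_{\alpha,k}$ form a $\mathbb{Q}$-basis of $S_{\alpha,k}$. 2. $S_{\alpha,k} \cong \mathbb{Q}[\mathcal{OP}_{\alpha,k}]$ as ungraded $\mathfrak{S}_\alpha$-modules. 3. $J_{\alpha,k} = \mathbf{T}(Z_{\alpha,k})$ for every choice of distinct rational numbers $\eta_1, \dots, \eta_k$. -/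

import Mathlib

namespace SpanningConfig

noncomputable section

/-! ### Batches and the parabolic subgroup

The letters `1, …, n` are represented by `Fin n`, so that the letter `p + 1` is `p : Fin n`. -/

/-- The partial sum `α₁ + ⋯ + α_{i-1}` of the parts of `α` strictly before the part `i`. -/
def batchStart {r : ℕ} (α : Fin r → ℕ) (i : Fin r) : ℕ :=
  ∑ l ∈ Finset.univ.filter (fun l => l < i), α l

/-- The `i`-th batch of letters. -/
def batch (n : ℕ) {r : ℕ} (α : Fin r → ℕ) (i : Fin r) : Finset (Fin n) :=
  Finset.univ.filter
    (fun p => batchStart α i ≤ (p : ℕ) ∧ (p : ℕ) < batchStart α i + α i)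

/-- The parabolic subgroup `𝔖_α` of `𝔖_n`: the permutations of the letters that map every
batch to itself. -/
def parabolic (n : ℕ) {r : ℕ} (α : Fin r → ℕ) : Subgroup (Equiv.Perm (Fin n)) where
  carrier := {π | ∀ i p, π p ∈ batch n α i ↔ p ∈ batch n α i}
  mul_mem' := by
    intro a b ha hb i p
    rw [Equiv.Perm.mul_apply, ha, hb]
  one_mem' := by
    intro i p
    rfl
  inv_mem' := by
    intro a ha i p
    rw [← ha i (a⁻¹ p), show a (a⁻¹ p) = p from a.apply_symm_apply p]

/-! ### The ring `S_{α,k}` -/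

/-- The complete homogeneous symmetric polynomial of degree `d` in the variables `x_p`, `p ∈ B`. -/
def hsymmOn {n : ℕ} (B : Finset (Fin n)) (d : ℕ) : MvPolynomial (Fin n) ℚ :=
  MvPolynomial.rename Subtype.val (MvPolynomial.hsymm {p // p ∈ B} ℚ d)

/-- The generators of `J_{α,k}`: the polynomials `e_d(x₁, …, x_n)` with `n - k + 1 ≤ d ≤ n`, and
for each `i` the polynomials `h_d` with `k - α_i + 1 ≤ d ≤ k` in the `i`-th batch of variables. -/
def generators (n : ℕ) {r : ℕ} (α : Fin r → ℕ) (k : ℕ) : Set (MvPolynomial (Fin n) ℚ) :=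
  {f | ∃ d : ℕ, n + 1 ≤ d + k ∧ d ≤ n ∧ f = MvPolynomial.esymm (Fin n) ℚ d} ∪
  {f | ∃ (i : Fin r) (d : ℕ), k + 1 ≤ d + α i ∧ d ≤ k ∧ f = hsymmOn (batch n α i) d}

/-- The ideal `J_{α,k}` of `ℚ[x₁, …, x_n]`. -/
def idealJ (n : ℕ) {r : ℕ} (α : Fin r → ℕ) (k : ℕ) : Ideal (MvPolynomial (Fin n) ℚ) :=
  Ideal.span (generators n α k)

/-- The quotient ring `S_{α,k} = ℚ[x₁, …, x_n] / J_{α,k}`. -/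
abbrev ringS (n : ℕ) {r : ℕ} (α : Fin r → ℕ) (k : ℕ) : Type :=
  MvPolynomial (Fin n) ℚ ⧸ idealJ n α k

theorem rename_hsymmOn {n r : ℕ} {α : Fin r → ℕ} {π : Equiv.Perm (Fin n)}
    (hπ : π ∈ parabolic n α) (i : Fin r) (d : ℕ) :
    MvPolynomial.rename π (hsymmOn (batch n α i) d) = hsymmOn (batch n α i) d := by
  have key : ∀ p, p ∈ batch n α i ↔ π p ∈ batch n α i := fun p => (hπ i p).symm
  unfold hsymmOn
  conv_rhs => rw [← MvPolynomial.rename_hsymm _ ℚ d (π.subtypeEquiv key)]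
  rw [MvPolynomial.rename_rename, MvPolynomial.rename_rename]
  rfl

theorem idealJ_le_comap {n r : ℕ} (α : Fin r → ℕ) (k : ℕ) {π : Equiv.Perm (Fin n)}
    (hπ : π ∈ parabolic n α) :
    idealJ n α k ≤ (idealJ n α k).comap (MvPolynomial.rename (R := ℚ) π) := by
  refine Ideal.span_le.2 ?_
  rintro f (⟨d, h1, h2, rfl⟩ | ⟨i, d, h1, h2, rfl⟩)
  · rw [SetLike.mem_coe, Ideal.mem_comap, MvPolynomial.rename_esymm]
    exact Ideal.subset_span (Or.inl ⟨d, h1, h2, rfl⟩)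
  · rw [SetLike.mem_coe, Ideal.mem_comap, rename_hsymmOn hπ]
    exact Ideal.subset_span (Or.inr ⟨i, d, h1, h2, rfl⟩)

/-- The ring endomorphism of `S_{α,k}` induced by the substitution `x_p ↦ x_{π(p)}`, `π ∈ 𝔖_α`. -/
def substS (n : ℕ) {r : ℕ} (α : Fin r → ℕ) (k : ℕ) (π : parabolic n α) :
    ringS n α k →ₐ[ℚ] ringS n α k :=
  Ideal.quotientMapₐ (idealJ n α k) (MvPolynomial.rename (R := ℚ) (π : Equiv.Perm (Fin n)))
    (idealJ_le_comap α k π.2)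

theorem substS_mk (n : ℕ) {r : ℕ} (α : Fin r → ℕ) (k : ℕ) (π : parabolic n α)
    (f : MvPolynomial (Fin n) ℚ) :
    substS n α k π (Ideal.Quotient.mk (idealJ n α k) f) =
      Ideal.Quotient.mk (idealJ n α k) (MvPolynomial.rename (π : Equiv.Perm (Fin n)) f) :=
  rfl

/-- The ungraded `𝔖_α`-module `S_{α,k}`: `π` acts by the substitution `x_p ↦ x_{π(p)}`. -/
def repS (n : ℕ) {r : ℕ} (α : Fin r → ℕ) (k : ℕ) :
    Representation ℚ (parabolic n α) (ringS n α k) where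
  toFun π := (substS n α k π).toLinearMap
  map_one' := by
    refine LinearMap.ext fun x => ?_
    obtain ⟨f, rfl⟩ := Ideal.Quotient.mk_surjective x
    change substS n α k 1 (Ideal.Quotient.mk (idealJ n α k) f) = Ideal.Quotient.mk _ f
    rw [substS_mk]
    congr 1
    exact MvPolynomial.rename_id_apply f
  map_mul' a b := by
    refine LinearMap.ext fun x => ?_
    obtain ⟨f, rfl⟩ := Ideal.Quotient.mk_surjective x
    change substS n α k (a * b) (Ideal.Quotient.mk (idealJ n α k) f) =
      substS n α k a (substS n α k b (Ideal.Quotient.mk (idealJ n α k) f))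
    rw [substS_mk, substS_mk, substS_mk, MvPolynomial.rename_rename]
    rfl

/-! ### The `neglex` order and standard monomials

A monomial `x₁^{a₁} ⋯ x_n^{a_n}` is represented by its exponent vector `a : Fin n →₀ ℕ`. -/

/-- Reversing the order of the variables. -/
def revExponents (n : ℕ) : (Fin n →₀ ℕ) ≃+ (Fin n →₀ ℕ) :=
  Finsupp.domCongr Fin.revPerm

/-- The `neglex` order: the lexicographic order with respect to `x_n > ⋯ > x₁`. -/
def neglex (n : ℕ) : MonomialOrder (Fin n) where
  syn := Lex (Fin n →₀ ℕ)
  toSyn := (revExponents n).trans MonomialOrder.lex.toSyn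
  toSyn_monotone := by
    intro a b h
    refine MonomialOrder.lex.toSyn_monotone ?_
    intro p
    exact h _

open scoped MonomialOrder in
/-- The defining description of the `neglex` order. -/
theorem neglex_lt_iff {n : ℕ} (a b : Fin n →₀ ℕ) :
    a ≺[neglex n] b ↔ ∃ i, a i < b i ∧ ∀ j, i < j → a j = b j := by
  change toLex (revExponents n a) < toLex (revExponents n b) ↔ _
  rw [Finsupp.Lex.lt_iff]
  constructor
  · rintro ⟨i, h1, h2⟩
    refine ⟨Fin.rev i, h2, fun j hj => ?_⟩
    have := h1 (Fin.rev j) (by rw [← Fin.rev_lt_rev, Fin.rev_rev]; exact hj)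
    simpa [revExponents] using this
  · rintro ⟨i, h1, h2⟩
    refine ⟨Fin.rev i, fun j hj => ?_, by simpa [revExponents] using h1⟩
    have := h2 (Fin.rev j) (by rw [← Fin.rev_lt_rev, Fin.rev_rev]; exact hj)
    simpa [revExponents] using this

/-- The initial ideal `in_<(I)` under the `neglex` order, generated by the leading monomials of the
nonzero elements of `I`. -/
def initialIdeal {n : ℕ} (I : Ideal (MvPolynomial (Fin n) ℚ)) : Ideal (MvPolynomial (Fin n) ℚ) :=
  Ideal.span {m | ∃ f ∈ I, f ≠ 0 ∧ m = MvPolynomial.monomial ((neglex n).degree f) 1}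

/-- The standard monomials of `ℚ[x₁, …, x_n] / I` under the `neglex` order: the monomials
outside the initial ideal of `I`. -/
def standardMonomials {n : ℕ} (I : Ideal (MvPolynomial (Fin n) ℚ)) : Set (Fin n →₀ ℕ) :=
  {a | MvPolynomial.monomial a 1 ∉ initialIdeal I}

/-! ### Nonskip monomials -/

/-- The skip sequence `γ(S)` of `S = {s₁ < ⋯ < s_t}`: its `i`-th entry is `i - j + 1` if `i = s_j`,
and `0` if `i ∉ S`. The entry at `p : Fin n` has `i = p + 1`, and `j` is the number of elements
of `S` that are at most `p`. -/
def skipSeq {n : ℕ} (S : Finset (Fin n)) (p : Fin n) : ℕ :=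
  if p ∈ S then ((p : ℕ) + 1) - (S.filter (fun q => q ≤ p)).card + 1 else 0

/-- The exponent vector `γ(S)* = (γ_n, …, γ₁)` of the reverse skip monomial `x(S)*`. -/
def revSkipMonomial {n : ℕ} (S : Finset (Fin n)) : Fin n →₀ ℕ :=
  Finsupp.equivFunOnFinite.symm (fun p => skipSeq S (Fin.rev p))

/-- The set `M_{α,k}` of `α`-nonskip monomials: no reverse skip monomial `x(S)*` with
`|S| = n - k + 1` divides the monomial, and for `1 ≤ j ≤ α_i` the power with exponent `k - j + 1`
of the `j`-th variable of the `i`-th batch does not divide it. -/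
def nonskip (n : ℕ) {r : ℕ} (α : Fin r → ℕ) (k : ℕ) : Set (Fin n →₀ ℕ) :=
  {a | (∀ S : Finset (Fin n), S.card + k = n + 1 → ¬ revSkipMonomial S ≤ a) ∧
    ∀ (i : Fin r) (j : ℕ), 1 ≤ j → j ≤ α i → ∀ p : Fin n, (p : ℕ) + 1 = batchStart α i + j →
      ¬ k - j + 1 ≤ a p}

/-! ### Ordered set partitions -/

/-- The set `OP_{α,k}` of ordered set partitions `(B₁ ∣ ⋯ ∣ B_k)` of the letters into `k` nonempty
blocks such that the letters of each batch lie in distinct blocks. -/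
@[ext]
structure OP (n : ℕ) {r : ℕ} (α : Fin r → ℕ) (k : ℕ) where
  block : Fin k → Finset (Fin n)
  nonempty : ∀ j, (block j).Nonempty
  disjoint : ∀ j l, j ≠ l → Disjoint (block j) (block l)
  cover : ∀ p, ∃ j, p ∈ block j
  distinct : ∀ i, ∀ p ∈ batch n α i, ∀ q ∈ batch n α i, p ≠ q → ∀ j,
    ¬ (p ∈ block j ∧ q ∈ block j)

/-- The action of `𝔖_α` on `OP_{α,k}` by permutation of the letters. -/
instance (n : ℕ) {r : ℕ} (α : Fin r → ℕ) (k : ℕ) : MulAction (parabolic n α) (OP n α k) where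
  smul π σ :=
    { block := fun j => (σ.block j).map (π : Equiv.Perm (Fin n)).toEmbedding
      nonempty := fun j => (σ.nonempty j).map
      disjoint := fun j l h => (Finset.disjoint_map _).2 (σ.disjoint j l h)
      cover := fun p => by
        obtain ⟨j, hj⟩ := σ.cover ((π : Equiv.Perm (Fin n)).symm p)
        exact ⟨j, by rw [Finset.mem_map_equiv]; exact hj⟩
      distinct := fun i p hp q hq hpq j h => by
        rw [Finset.mem_map_equiv, Finset.mem_map_equiv] at h
        refine σ.distinct i _ ?_ _ ?_ (fun e => hpq (Equiv.injective _ e)) j h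
        · rw [← π.2 i, Equiv.apply_symm_apply]
          exact hp
        · rw [← π.2 i, Equiv.apply_symm_apply]
          exact hq }
  one_smul σ := by
    refine OP.ext (funext fun j => ?_)
    exact Finset.map_refl
  mul_smul a b σ := by
    refine OP.ext (funext fun j => ?_)
    exact (Finset.map_map (b : Equiv.Perm (Fin n)).toEmbedding
      (a : Equiv.Perm (Fin n)).toEmbedding (σ.block j)).symm

/-- The `𝔖_α`-module `ℚ[OP_{α,k}]`. -/
abbrev repOP (n : ℕ) {r : ℕ} (α : Fin r → ℕ) (k : ℕ) :=
  Representation.ofMulAction ℚ (parabolic n α) (OP n α k)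

/-! ### Orbit harmonics -/

/-- The point locus `Z_{α,k}` in `ℚⁿ` attached to distinct rational numbers `η₁, …, η_k`. -/
def locus (n : ℕ) {r : ℕ} (α : Fin r → ℕ) {k : ℕ} (η : Fin k → ℚ) : Set (Fin n → ℚ) :=
  {z | Set.range z = Set.range η ∧ ∀ i, Set.InjOn z (batch n α i : Set (Fin n))}

/-- The top degree component `τ(f)` of a polynomial. -/
def topComponent {n : ℕ} (f : MvPolynomial (Fin n) ℚ) : MvPolynomial (Fin n) ℚ :=
  MvPolynomial.homogeneousComponent f.totalDegree f

/-- The ideal `T(Z)` generated by the top degree components of the nonzero polynomials that vanish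
on `Z`. -/
def idealT {n : ℕ} (Z : Set (Fin n → ℚ)) : Ideal (MvPolynomial (Fin n) ℚ) :=
  Ideal.span {g | ∃ f ∈ MvPolynomial.vanishingIdeal ℚ Z, f ≠ 0 ∧ g = topComponent f}

end

end SpanningConfig

/-! All parts follow from a dimension sandwich. For `k ≤ n + 1`, |OP| = dim ℚ[x]/T(Z) ≤ dim ℚ[x]/J ≤
|M| ≤ |OP|, so every inequality is an equality. For `k > n + 1` the generator e_0 = 1 makes J and
T(Z) the unit ideal.

J ⊆ T(Z) (`idealJ_le_idealT`): at a point z of Z every η occurs among the coordinates, so ∏(1 - z_p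
t)/∏(1 - η_j t) is a polynomial in t of degree n - k; its higher coefficients give relations on Z
with top component ±e_d. The inverse quotient, with z restricted to one batch, has degree k - α_i
and gives the h_d in the same way.

dim ℚ[x]/T(Z) = |Z| (`exists_quotient_equiv`): take the form on polynomials with the monomials
orthonormal. It is positive definite, and the orthogonal complement H of T(Z) is a complement both
of T(Z) and of the vanishing ideal of Z. Thus ℚ[x]/T(Z) ≅ H ≅ functions on Z, and Z is in bijection
with OP. The form is invariant under permuting variables, so H is stable and the isomorphism is
equivariant; this gives the module statement.

dim ℚ[x]/J ≤ |M| (`exists_degree_eq_of_notMem_nonskip`, `span_monomials_eq_top`): every monomial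
that is not nonskip is the leading monomial of an element of J. For a power of a batch variable the
element is an h_d in a prefix of the batch; for a reverse skip monomial it is a flagged Jacobi–Trudi
determinant.

|M| ≤ |OP| (`exists_injective_nonskip`): read the exponents from the last to the first, keeping
count of the blocks still to be covered. A nonskip vector always ends with nothing left to cover.
Building a word from left to right, the exponent of a letter then selects its block from a list of
admissible ones, and can be recovered from the word. -/

namespace SpanningConfig

noncomputable section


/-! ### Elementary and complete symmetric functions of a finite family -/

section SymmetricFunctions

variable {ι κ R : Type*} [CommRing R]

/-- The elementary symmetric function of degree `d` of the family `f i`, `i ∈ s`. -/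
def eSym (f : ι → R) (s : Finset ι) (d : ℕ) : R :=
  ∑ t ∈ s.powersetCard d, ∏ i ∈ t, f i

/-- The complete homogeneous symmetric function of degree `d` of the family `f i`, `i ∈ s`. -/
def hSym (f : ι → R) (s : Finset ι) (d : ℕ) : R :=
  PowerSeries.coeff d (∏ i ∈ s, PowerSeries.mk fun m => f i ^ m)

theorem eSym_zero (f : ι → R) (s : Finset ι) : eSym f s 0 = 1 := by
  simp [eSym]

theorem eSym_eq_zero (f : ι → R) (s : Finset ι) {d : ℕ} (h : s.card < d) : eSym f s d = 0 := by
  simp [eSym, Finset.powersetCard_eq_empty.2 h]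

theorem hSym_zero (f : ι → R) (s : Finset ι) : hSym f s 0 = 1 := by
  simp [hSym, map_prod]

theorem hSym_eq_sum [DecidableEq ι] (f : ι → R) (s : Finset ι) (d : ℕ) :
    hSym f s d = ∑ l ∈ s.finsuppAntidiag d, ∏ i ∈ s, f i ^ l i := by
  simp [hSym, PowerSeries.coeff_prod]

theorem hSym_image (f : κ → R) (g : ι → κ) (s : Finset ι) [DecidableEq κ]
    (hg : Set.InjOn g s) (d : ℕ) : hSym f (s.image g) d = hSym (fun i => f (g i)) s d := by
  rw [hSym, hSym, Finset.prod_image hg]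

theorem mk_pow_mul_one_sub (a : R) :
    (PowerSeries.mk fun m => a ^ m) * (1 - PowerSeries.C a * PowerSeries.X) = 1 := by
  ext m
  cases m with
  | zero => simp [mul_sub]
  | succ m =>
    rw [mul_sub, mul_one, mul_left_comm, map_sub, PowerSeries.coeff_C_mul,
      PowerSeries.coeff_succ_mul_X]
    simp [pow_succ', PowerSeries.coeff_one]

theorem hSym_insert_succ [DecidableEq ι] (f : ι → R) (s : Finset ι) {p : ι} (hp : p ∉ s) (d : ℕ) :
    hSym f (insert p s) (d + 1) = hSym f s (d + 1) + f p * hSym f (insert p s) d := by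
  set A := ∏ i ∈ s, PowerSeries.mk fun m => f i ^ m with hA
  have h1 : (PowerSeries.mk fun m => f p ^ m) * A =
      A + PowerSeries.C (f p) * (((PowerSeries.mk fun m => f p ^ m) * A) * PowerSeries.X) := by
    linear_combination A * mk_pow_mul_one_sub (f p)
  rw [hSym, hSym, hSym, Finset.prod_insert hp, ← hA]
  conv_lhs => rw [h1]
  rw [map_add, PowerSeries.coeff_C_mul, PowerSeries.coeff_succ_mul_X]

theorem coeff_prod_one_sub (f : ι → R) (s : Finset ι) (d : ℕ) :
    PowerSeries.coeff d (∏ i ∈ s, (1 - PowerSeries.C (f i) * PowerSeries.X)) =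
      (-1) ^ d * eSym f s d := by
  classical
  simp only [sub_eq_add_neg, Finset.prod_one_add, map_sum, eSym, Finset.mul_sum]
  rw [Finset.powersetCard_eq_filter, Finset.sum_filter]
  refine Finset.sum_congr rfl fun t _ => ?_
  have : ∏ i ∈ t, -(PowerSeries.C (f i) * PowerSeries.X) =
      PowerSeries.C ((-1) ^ t.card * ∏ i ∈ t, f i) * PowerSeries.X ^ t.card := by
    rw [Finset.prod_neg, Finset.prod_mul_distrib, Finset.prod_const, map_mul, map_prod, map_pow,
      map_neg, map_one, mul_assoc]
  rw [this, PowerSeries.coeff_C_mul, PowerSeries.coeff_X_pow]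
  by_cases h : t.card = d
  · simp [h]
  · simp [h, Ne.symm h]

/-- The alternating sum is the coefficient of degree d in ∏_{s}(1 - f_i X) / ∏_{t}(1 - f_i X) = ∏_{s
\ t}(1 - f_i X), a polynomial of degree at most |s| - |t| < d. This one identity produces the
relations on the locus and the relations behind the flagged determinant. -/
theorem sum_eSym_mul_hSym_eq_zero (f : ι → R) {s t : Finset ι} (hst : t ⊆ s) {d : ℕ}
    (hd : s.card < d + t.card) :
    ∑ x ∈ Finset.HasAntidiagonal.antidiagonal d, (-1) ^ x.1 * eSym f s x.1 * hSym f t x.2 = 0 := by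
  classical
  have key : (∏ i ∈ s, (1 - PowerSeries.C (f i) * PowerSeries.X)) *
      (∏ i ∈ t, PowerSeries.mk fun m => f i ^ m) =
      ∏ i ∈ s \ t, (1 - PowerSeries.C (f i) * PowerSeries.X) := by
    rw [← Finset.prod_sdiff hst, mul_assoc, ← Finset.prod_mul_distrib]
    rw [Finset.prod_congr rfl (fun i _ => (mul_comm _ _).trans (mk_pow_mul_one_sub (f i)))]
    simp
  have := congrArg (PowerSeries.coeff d) key
  rw [PowerSeries.coeff_mul, coeff_prod_one_sub, eSym_eq_zero, mul_zero] at this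
  · rw [← this]
    exact Finset.sum_congr rfl fun x _ => by rw [coeff_prod_one_sub, hSym]
  · rw [Finset.card_sdiff_of_subset hst]
    have := Finset.card_le_card hst
    omega

end SymmetricFunctions

theorem aeval_eSym_X {n : ℕ} (z : Fin n → ℚ) (s : Finset (Fin n)) (d : ℕ) :
    MvPolynomial.aeval z (eSym (MvPolynomial.X (R := ℚ)) s d) = eSym z s d := by
  simp [eSym, map_sum, map_prod]

theorem aeval_hSym_X {n : ℕ} (z : Fin n → ℚ) (s : Finset (Fin n)) (d : ℕ) :
    MvPolynomial.aeval z (hSym (MvPolynomial.X (R := ℚ)) s d) = hSym z s d := by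
  simp [hSym_eq_sum, map_sum, map_prod]

theorem esymm_eq_eSym (n d : ℕ) :
    MvPolynomial.esymm (Fin n) ℚ d = eSym MvPolynomial.X Finset.univ d :=
  rfl

theorem hSym_X_eq_sum {n : ℕ} (B : Finset (Fin n)) (d : ℕ) :
    hSym (MvPolynomial.X (R := ℚ)) B d =
      ∑ l ∈ B.finsuppAntidiag d, MvPolynomial.monomial l 1 := by
  rw [hSym_eq_sum]
  refine Finset.sum_congr rfl fun l hl => ?_
  rw [MvPolynomial.monomial_eq, map_one, one_mul, Finsupp.prod]
  refine (Finset.prod_subset (Finset.mem_finsuppAntidiag.1 hl).2 fun i _ hi => ?_).symm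
  rw [Finsupp.notMem_support_iff.1 hi, pow_zero]

theorem monomial_toFinsupp {σ : Type*} [DecidableEq σ] (m : Multiset σ) :
    MvPolynomial.monomial (Multiset.toFinsupp m) (1 : ℚ) = (m.map MvPolynomial.X).prod := by
  induction m using Multiset.induction_on with
  | empty => simp
  | cons a m ih =>
    rw [← Multiset.singleton_add, map_add, Multiset.toFinsupp_singleton,
      MvPolynomial.monomial_single_add, ih, Multiset.singleton_add, Multiset.map_cons,
      Multiset.prod_cons, pow_one]

theorem hsymmOn_eq_hSym {n : ℕ} (B : Finset (Fin n)) (d : ℕ) :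
    hsymmOn B d = hSym MvPolynomial.X B d := by
  rw [hSym_X_eq_sum, hsymmOn, MvPolynomial.hsymm, map_sum]
  refine Finset.sum_bij' (fun s _ => Multiset.toFinsupp (s.1.map Subtype.val))
    (fun l hl => ⟨(Finsupp.toMultiset l).attach.map fun x => ⟨x.1,
      (Finset.mem_finsuppAntidiag'.1 hl).2 (by
        have := x.2
        rwa [Finsupp.mem_toMultiset] at this)⟩, by
        rw [Multiset.card_map, Multiset.card_attach, Finsupp.card_toMultiset]
        exact (Finset.mem_finsuppAntidiag'.1 hl).1⟩) ?_ ?_ ?_ ?_ ?_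
  · intro s _
    rw [Finset.mem_finsuppAntidiag']
    constructor
    · refine (Finsupp.card_toMultiset _).symm.trans ?_
      rw [Multiset.toFinsupp_toMultiset, Multiset.card_map]
      exact s.2
    · intro p hp
      rw [Multiset.toFinsupp_support, Multiset.mem_toFinset, Multiset.mem_map] at hp
      obtain ⟨q, _, rfl⟩ := hp
      exact q.2
  · intro _ _
    exact Finset.mem_univ _
  · intro s _
    apply Subtype.ext
    apply Multiset.map_injective Subtype.val_injective
    simp [Multiset.map_map]
  · intro l hl
    simp [Multiset.map_map]
  · intro s _
    rw [map_multiset_prod, monomial_toFinsupp]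
    simp only [Multiset.map_map, Function.comp_def, MvPolynomial.rename_X]


/-! ### The generators of `J_{α,k}` are top degree components -/

theorem homogeneousComponent_mem_idealT {n : ℕ} {Z : Set (Fin n → ℚ)}
    {f : MvPolynomial (Fin n) ℚ} (hf : f ∈ MvPolynomial.vanishingIdeal ℚ Z) {d : ℕ}
    (hd : f.totalDegree ≤ d) : MvPolynomial.homogeneousComponent d f ∈ idealT Z := by
  rcases hd.eq_or_lt with rfl | h
  · by_cases h0 : f = 0
    · rw [h0, map_zero]
      exact zero_mem _
    · exact Ideal.subset_span ⟨f, hf, h0, rfl⟩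
  · rw [MvPolynomial.homogeneousComponent_eq_zero d f h]
    exact zero_mem _

/-- The hypothesis says that ∑ c_{d-j} P_j vanishes on Z, and its component of degree d is P_d
because c 0 = 1. -/
theorem mem_idealT_of_vanishing {n : ℕ} {Z : Set (Fin n → ℚ)} (P : ℕ → MvPolynomial (Fin n) ℚ)
    (hP : ∀ i, (P i).IsHomogeneous i) (c : ℕ → ℚ) (hc : c 0 = 1) (d : ℕ)
    (h : ∀ z ∈ Z, ∑ x ∈ Finset.HasAntidiagonal.antidiagonal d,
      MvPolynomial.aeval z (P x.1) * c x.2 = 0) :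
    P d ∈ idealT Z := by
  set F := ∑ x ∈ Finset.HasAntidiagonal.antidiagonal d, MvPolynomial.C (c x.2) * P x.1 with hF
  have hvan : F ∈ MvPolynomial.vanishingIdeal ℚ Z := by
    intro z hz
    rw [hF, map_sum, ← h z hz]
    refine Finset.sum_congr rfl fun x _ => ?_
    rw [map_mul, MvPolynomial.aeval_C, mul_comm]
    rfl
  have hdeg : F.totalDegree ≤ d := by
    refine MvPolynomial.totalDegree_finsetSum_le fun x hx => ?_
    refine ((hP x.1).C_mul (c x.2)).totalDegree_le.trans ?_
    have := Finset.HasAntidiagonal.mem_antidiagonal.1 hx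
    omega
  have hcomp : MvPolynomial.homogeneousComponent d F = P d := by
    rw [hF, map_sum, Finset.sum_eq_single (d, 0)]
    · rw [MvPolynomial.homogeneousComponent_C_mul, hc, map_one, one_mul,
        MvPolynomial.homogeneousComponent_eq_self (hP d)]
    · intro x hx hne
      rw [MvPolynomial.homogeneousComponent_C_mul, MvPolynomial.homogeneousComponent_of_mem (hP x.1),
        if_neg, mul_zero]
      rintro h
      have := Finset.HasAntidiagonal.mem_antidiagonal.1 hx
      exact hne (Prod.ext h.symm (by dsimp only; omega))
    · intro h
      exact absurd (Finset.HasAntidiagonal.mem_antidiagonal.2 (add_zero d)) h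
  rw [← hcomp]
  exact homogeneousComponent_mem_idealT hvan hdeg

theorem isHomogeneous_eSym_X (n d : ℕ) :
    (eSym (MvPolynomial.X (R := ℚ)) (Finset.univ : Finset (Fin n)) d).IsHomogeneous d := by
  refine MvPolynomial.IsHomogeneous.sum _ _ _ fun t ht => ?_
  have := MvPolynomial.IsHomogeneous.prod t (fun i => MvPolynomial.X (R := ℚ) i) (fun _ => 1)
    fun i _ => MvPolynomial.isHomogeneous_X ℚ i
  rwa [Finset.sum_const, smul_eq_mul, mul_one, (Finset.mem_powersetCard.1 ht).2] at this

theorem isHomogeneous_hSym_X {n : ℕ} (B : Finset (Fin n)) (d : ℕ) :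
    (hSym (MvPolynomial.X (R := ℚ)) B d).IsHomogeneous d := by
  rw [hSym_X_eq_sum]
  refine MvPolynomial.IsHomogeneous.sum _ _ _ fun l hl => ?_
  refine MvPolynomial.isHomogeneous_monomial _ ?_
  rw [Finset.mem_finsuppAntidiag'] at hl
  exact hl.1

/-! ### Batches as consecutive intervals covering the letters. -/

theorem batchStart_add_le {r : ℕ} (α : Fin r → ℕ) (i : Fin r) :
    batchStart α i + α i ≤ ∑ l, α l := by
  rw [batchStart, add_comm, ← Finset.sum_insert (by simp)]
  exact Finset.sum_le_sum_of_subset (Finset.subset_univ _)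

theorem card_batch {n r : ℕ} {α : Fin r → ℕ} (hn : ∑ i, α i = n) (i : Fin r) :
    (batch n α i).card = α i := by
  have h := batchStart_add_le α i
  rw [hn] at h
  have : (batch n α i).map Fin.valEmbedding =
      Finset.Ico (batchStart α i) (batchStart α i + α i) := by
    ext p
    simp only [Finset.mem_map, batch, Finset.mem_filter, Finset.mem_univ, true_and,
      Fin.valEmbedding_apply, Finset.mem_Ico]
    constructor
    · rintro ⟨q, hq, rfl⟩
      exact hq
    · intro hp
      exact ⟨⟨p, by omega⟩, hp, rfl⟩
  rw [← Finset.card_map Fin.valEmbedding, this, Nat.card_Ico]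
  omega

theorem batchStart_add_le_of_lt {r : ℕ} (α : Fin r → ℕ) {i j : Fin r} (h : i < j) :
    batchStart α i + α i ≤ batchStart α j := by
  rw [batchStart, batchStart, add_comm, ← Finset.sum_insert (by simp)]
  refine Finset.sum_le_sum_of_subset fun l hl => ?_
  simp only [Finset.mem_insert, Finset.mem_filter, Finset.mem_univ, true_and] at hl ⊢
  rcases hl with rfl | hl
  · exact h
  · exact hl.trans h

theorem exists_mem_batch {n r : ℕ} {α : Fin r → ℕ} (hn : ∑ i, α i = n) (p : Fin n) :
    ∃ i, p ∈ batch n α i := by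
  have hcard : (Finset.univ.biUnion (batch n α)).card = n := by
    rw [Finset.card_biUnion]
    · simp_rw [card_batch hn, hn]
    · intro i _ j _ hij
      refine Finset.disjoint_left.2 ?_
      intro q hqi hqj
      simp only [batch, Finset.mem_filter, Finset.mem_univ, true_and] at hqi hqj
      rcases lt_or_gt_of_ne hij with h | h
      · have := batchStart_add_le_of_lt α h
        omega
      · have := batchStart_add_le_of_lt α h
        omega
  have huniv : Finset.univ.biUnion (batch n α) = Finset.univ :=
    Finset.eq_univ_of_card _ (by rw [hcard, Fintype.card_fin])
  have := Finset.mem_univ p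
  rw [← huniv, Finset.mem_biUnion] at this
  obtain ⟨i, _, hi⟩ := this
  exact ⟨i, hi⟩

theorem idealJ_le_idealT {n r k : ℕ} {α : Fin r → ℕ} (hn : ∑ i, α i = n) {η : Fin k → ℚ}
    (hη : Function.Injective η) : idealJ n α k ≤ idealT (locus n α η) := by
  refine Ideal.span_le.2 ?_
  rintro f (⟨d, h1, h2, rfl⟩ | ⟨i, d, h1, h2, rfl⟩)
  · rw [esymm_eq_eSym]
    have := mem_idealT_of_vanishing (Z := locus n α η)
      (fun j => (-1) ^ j * eSym (MvPolynomial.X (R := ℚ)) (Finset.univ : Finset (Fin n)) j)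
      (fun j => by
        have := (isHomogeneous_eSym_X n j).C_mul ((-1) ^ j)
        simpa using this) (fun j => hSym η Finset.univ j) (hSym_zero _ _) d ?_
    · have := (idealT (locus n α η)).mul_mem_left ((-1) ^ d) this
      rwa [← mul_assoc, ← mul_pow, neg_one_mul, neg_neg, one_pow, one_mul] at this
    · rintro z ⟨hz, -⟩
      -- One position is chosen for each η; over these n - (n - k) = k positions the h_j of z are
      -- those of η.
      have hsec : ∀ l, ∃ p, z p = η l := fun l => by
        have : η l ∈ Set.range z := hz ▸ Set.mem_range_self l
        exact this
      choose g hg using hsec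
      have hginj : Function.Injective g := fun a b hab => hη (by rw [← hg, ← hg, hab])
      have := sum_eSym_mul_hSym_eq_zero z (Finset.subset_univ (Finset.univ.image g)) (d := d) (by
        rw [Finset.card_image_of_injective _ hginj, Finset.card_univ, Finset.card_univ,
          Fintype.card_fin, Fintype.card_fin]
        omega)
      rw [← this]
      refine Finset.sum_congr rfl fun x _ => ?_
      rw [hSym_image _ _ _ hginj.injOn, map_mul, map_pow, map_neg, map_one]
      rw [aeval_eSym_X]
      simp_rw [hg]
  · rw [hsymmOn_eq_hSym]
    refine mem_idealT_of_vanishing (Z := locus n α η)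
      (fun j => hSym (MvPolynomial.X (R := ℚ)) (batch n α i) j)
      (fun j => isHomogeneous_hSym_X _ j) (fun j => (-1) ^ j * eSym η Finset.univ j)
      (by simp [eSym_zero]) d ?_
    rintro z ⟨hz, hz'⟩
    -- The roles are exchanged: the coordinates of the batch are α_i distinct members of the family
    -- η, so the identity is applied to η and this subfamily.
    have hsec : ∀ p, ∃ l, η l = z p := fun p => by
      have : z p ∈ Set.range η := hz ▸ Set.mem_range_self p
      exact this
    choose g hg using hsec
    have hginj : Set.InjOn g (batch n α i) := fun a ha b hb hab =>
      hz' i ha hb (by rw [← hg, ← hg, hab])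
    have := sum_eSym_mul_hSym_eq_zero η (Finset.subset_univ ((batch n α i).image g)) (d := d) (by
        rw [Finset.card_image_of_injOn hginj, Finset.card_univ, Fintype.card_fin, card_batch hn]
        omega)
    rw [← this, ← Finset.Nat.sum_antidiagonal_swap]
    refine Finset.sum_congr rfl fun x _ => ?_
    rw [hSym_image _ _ _ hginj]
    simp_rw [hg]
    rw [mul_comm, aeval_hSym_X]
    rfl


/-! ### Orbit harmonics -/

section GradedPart

attribute [local instance] MvPolynomial.gradedAlgebra

theorem homogeneousComponent_X_mul {n : ℕ} (i : Fin n) (g : MvPolynomial (Fin n) ℚ) (j : ℕ) :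
    MvPolynomial.homogeneousComponent (1 + j) (MvPolynomial.X i * g) =
      MvPolynomial.X i * MvPolynomial.homogeneousComponent j g := by
  have := DirectSum.coe_decompose_mul_add_of_left_mem
    (MvPolynomial.homogeneousSubmodule (Fin n) ℚ) (i := 1) (j := j) (b := g)
    (MvPolynomial.isHomogeneous_X ℚ i)
  rw [← MvPolynomial.decomposition.decompose'_apply, ← MvPolynomial.decomposition.decompose'_apply]
  exact this

end GradedPart

/-- Degree by degree, elements of T(Z) are leading forms of vanishing polynomials: the property
survives sums, and multiplication by a variable shifts the degree by one. In particular T(Z) is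
graded. -/
theorem exists_vanishing_of_mem_idealT {n : ℕ} {Z : Set (Fin n → ℚ)}
    {t : MvPolynomial (Fin n) ℚ} (ht : t ∈ idealT Z) (d : ℕ) :
    ∃ g ∈ MvPolynomial.vanishingIdeal ℚ Z, g.totalDegree ≤ d ∧
      MvPolynomial.homogeneousComponent d g = MvPolynomial.homogeneousComponent d t := by
  induction ht using Submodule.span_induction generalizing d with
  | mem t ht =>
    obtain ⟨f, hf, -, rfl⟩ := ht
    have htop : (topComponent f).IsHomogeneous f.totalDegree :=
      MvPolynomial.homogeneousComponent_isHomogeneous _ _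
    by_cases h : d = f.totalDegree
    · subst h
      exact ⟨f, hf, le_rfl, (MvPolynomial.homogeneousComponent_eq_self htop).symm⟩
    · refine ⟨0, zero_mem _, by simp, ?_⟩
      rw [MvPolynomial.homogeneousComponent_of_mem htop, if_neg h, map_zero]
  | zero => exact ⟨0, zero_mem _, by simp, rfl⟩
  | add s t _ _ hs ht =>
    obtain ⟨g, hg, hgd, hgc⟩ := hs d
    obtain ⟨g', hg', hgd', hgc'⟩ := ht d
    refine ⟨g + g', add_mem hg hg', (MvPolynomial.totalDegree_add _ _).trans (max_le hgd hgd'), ?_⟩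
    rw [map_add, map_add, hgc, hgc']
  | smul p t _ ht =>
    rw [smul_eq_mul]
    clear * - ht
    induction p using MvPolynomial.induction_on generalizing t d with
    | C a =>
      obtain ⟨g, hg, hgd, hgc⟩ := ht d
      refine ⟨MvPolynomial.C a * g, Ideal.mul_mem_left _ _ hg, ?_, ?_⟩
      · rw [MvPolynomial.C_mul']
        exact (MvPolynomial.totalDegree_smul_le _ _).trans hgd
      · rw [MvPolynomial.homogeneousComponent_C_mul, MvPolynomial.homogeneousComponent_C_mul, hgc]
    | add p q hp hq =>
      obtain ⟨g, hg, hgd, hgc⟩ := hp t ht d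
      obtain ⟨g', hg', hgd', hgc'⟩ := hq t ht d
      refine ⟨g + g', add_mem hg hg',
        (MvPolynomial.totalDegree_add _ _).trans (max_le hgd hgd'), ?_⟩
      rw [add_mul, map_add, map_add, hgc, hgc']
    | mul_X p i hp =>
      rw [mul_assoc]
      -- The variable is absorbed into t, so it remains to check the property for X i * t; its
      -- constant component is zero, which settles degree 0.
      refine hp _ (fun d => ?_) d
      rcases d with _ | d
      · refine ⟨0, zero_mem _, by simp, ?_⟩
        rw [map_zero, MvPolynomial.homogeneousComponent_zero, MvPolynomial.coeff_X_mul',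
          if_neg (by simp), map_zero]
      · obtain ⟨g, hg, hgd, hgc⟩ := ht d
        refine ⟨MvPolynomial.X i * g, Ideal.mul_mem_left _ _ hg, ?_, ?_⟩
        · refine (MvPolynomial.totalDegree_mul _ _).trans ?_
          rw [MvPolynomial.totalDegree_X]
          omega
        · rw [add_comm d 1, homogeneousComponent_X_mul, homogeneousComponent_X_mul, hgc]

theorem homogeneousComponent_mem_idealT_of_mem {n : ℕ} {Z : Set (Fin n → ℚ)}
    {t : MvPolynomial (Fin n) ℚ} (ht : t ∈ idealT Z) (d : ℕ) :
    MvPolynomial.homogeneousComponent d t ∈ idealT Z := by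
  obtain ⟨g, hg, hgd, hgc⟩ := exists_vanishing_of_mem_idealT ht d
  rw [← hgc]
  exact homogeneousComponent_mem_idealT hg hgd

/-- The bilinear form on polynomials for which the monomials are orthonormal. -/
def coeffForm (n : ℕ) : LinearMap.BilinForm ℚ (MvPolynomial (Fin n) ℚ) :=
  (MvPolynomial.basisMonomials (Fin n) ℚ).constr ℚ fun a => MvPolynomial.lcoeff ℚ a

theorem coeffForm_monomial {n : ℕ} (a : Fin n →₀ ℕ) (c : ℚ) (g : MvPolynomial (Fin n) ℚ) :
    coeffForm n (MvPolynomial.monomial a c) g = c * g.coeff a := by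
  have h := (MvPolynomial.basisMonomials (Fin n) ℚ).constr_basis ℚ
    (fun a => MvPolynomial.lcoeff ℚ a) a
  rw [MvPolynomial.coe_basisMonomials] at h
  have h2 : MvPolynomial.monomial a c = c • MvPolynomial.monomial a (1 : ℚ) := by
    rw [MvPolynomial.smul_monomial, smul_eq_mul, mul_one]
  rw [h2, map_smul, coeffForm, h]
  rfl

theorem coeffForm_apply {n : ℕ} (f g : MvPolynomial (Fin n) ℚ) :
    coeffForm n f g = ∑ a ∈ f.support, f.coeff a * g.coeff a := by
  conv_lhs => rw [f.as_sum]
  rw [map_sum, LinearMap.sum_apply]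
  exact Finset.sum_congr rfl fun a _ => coeffForm_monomial _ _ _

theorem coeffForm_self_eq_zero {n : ℕ} {f : MvPolynomial (Fin n) ℚ} (h : coeffForm n f f = 0) :
    f = 0 := by
  rw [coeffForm_apply, Finset.sum_eq_zero_iff_of_nonneg fun a _ => mul_self_nonneg _] at h
  by_contra hf
  obtain ⟨a, ha⟩ := MvPolynomial.support_nonempty.2 hf
  exact MvPolynomial.mem_support_iff.1 ha (mul_self_eq_zero.1 (h a ha))

theorem coeffForm_rename {n : ℕ} (π : Equiv.Perm (Fin n)) (f g : MvPolynomial (Fin n) ℚ) :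
    coeffForm n (MvPolynomial.rename π f) (MvPolynomial.rename π g) = coeffForm n f g := by
  induction f using MvPolynomial.induction_on' with
  | monomial a c =>
    rw [MvPolynomial.rename_monomial, coeffForm_monomial, coeffForm_monomial,
      MvPolynomial.coeff_rename_mapDomain _ π.injective]
  | add p q hp hq =>
    rw [map_add, map_add, map_add, LinearMap.add_apply, LinearMap.add_apply, hp, hq]

/-- The harmonic space of `Z`: the orthogonal complement of `T(Z)`. -/
def harmonics {n : ℕ} (Z : Set (Fin n → ℚ)) : Submodule ℚ (MvPolynomial (Fin n) ℚ) where
  carrier := {h | ∀ t ∈ idealT Z, coeffForm n h t = 0}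
  zero_mem' t _ := by simp
  add_mem' ha hb t ht := by rw [map_add, LinearMap.add_apply, ha t ht, hb t ht, add_zero]
  smul_mem' c a ha t ht := by rw [map_smul, LinearMap.smul_apply, ha t ht, smul_zero]

/-- Positive definiteness makes W → W* injective, hence surjective in finite dimension; the
functional of f on W is therefore represented by some w in W. -/
theorem exists_orthogonal_projection {n : ℕ} (W : Submodule ℚ (MvPolynomial (Fin n) ℚ))
    [FiniteDimensional ℚ W] (f : MvPolynomial (Fin n) ℚ) :
    ∃ w ∈ W, ∀ v ∈ W, coeffForm n (f - w) v = 0 := by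
  let φ : MvPolynomial (Fin n) ℚ →ₗ[ℚ] Module.Dual ℚ W := (coeffForm n).compl₂ W.subtype
  have hinj : Function.Injective (φ.comp W.subtype) := by
    rw [injective_iff_map_eq_zero]
    intro w hw
    have : coeffForm n w w = 0 := LinearMap.congr_fun hw w
    exact Subtype.ext (coeffForm_self_eq_zero this)
  have hsurj : Function.Surjective (φ.comp W.subtype) :=
    (LinearMap.injective_iff_surjective_of_finrank_eq_finrank
      (Subspace.dual_finrank_eq (K := ℚ) (V := W)).symm).1 hinj
  obtain ⟨w, hw⟩ := hsurj (φ f)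
  refine ⟨w, w.2, fun v hv => ?_⟩
  have : coeffForm n w v = coeffForm n f v := LinearMap.congr_fun hw ⟨v, hv⟩
  rw [map_sub, LinearMap.sub_apply, this, sub_self]

/-- T(Z) is infinite-dimensional in general, so f is projected onto its part of degree at most d.
Orthogonality to that part suffices: T(Z) is graded, and components of degree above d do not meet f
- t. -/
theorem exists_sub_mem_harmonics {n : ℕ} (Z : Set (Fin n → ℚ)) {f : MvPolynomial (Fin n) ℚ}
    {d : ℕ} (hf : f.totalDegree ≤ d) :
    ∃ t ∈ idealT Z, t.totalDegree ≤ d ∧ f - t ∈ harmonics Z := by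
  let W : Submodule ℚ (MvPolynomial (Fin n) ℚ) :=
    (idealT Z).restrictScalars ℚ ⊓ MvPolynomial.restrictTotalDegree (Fin n) ℚ d
  have : FiniteDimensional ℚ W := Submodule.finiteDimensional_inf_right _ _
  obtain ⟨t, ht, horth⟩ := exists_orthogonal_projection W f
  have htd : t.totalDegree ≤ d := (MvPolynomial.mem_restrictTotalDegree _ _ _).1 ht.2
  refine ⟨t, ht.1, htd, fun s hs => ?_⟩
  have hdeg : (f - t).totalDegree ≤ d := (MvPolynomial.totalDegree_sub _ _).trans (max_le hf htd)
  set s' := ∑ i ∈ Finset.range (d + 1), MvPolynomial.homogeneousComponent i s with hs'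
  have hs'W : s' ∈ W := by
    refine Submodule.sum_mem _ fun i hi => ⟨homogeneousComponent_mem_idealT_of_mem hs i, ?_⟩
    refine (MvPolynomial.mem_restrictTotalDegree _ _ _).2 ?_
    refine (MvPolynomial.homogeneousComponent_isHomogeneous i s).totalDegree_le.trans ?_
    rw [Finset.mem_range] at hi
    omega
  rw [← horth s' hs'W, coeffForm_apply, coeffForm_apply]
  refine Finset.sum_congr rfl fun a ha => ?_
  congr 1
  rw [hs', MvPolynomial.coeff_sum]
  simp_rw [MvPolynomial.coeff_homogeneousComponent]
  rw [Finset.sum_ite_eq, if_pos]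
  have := (MvPolynomial.le_totalDegree ha).trans hdeg
  rw [Finset.mem_range, Nat.lt_succ_iff]
  exact this

theorem isCompl_idealT_harmonics {n : ℕ} (Z : Set (Fin n → ℚ)) :
    IsCompl ((idealT Z).restrictScalars ℚ) (harmonics Z) := by
  constructor
  · rw [Submodule.disjoint_def]
    exact fun f hf hh => coeffForm_self_eq_zero (hh f hf)
  · rw [codisjoint_iff, eq_top_iff]
    intro f _
    obtain ⟨t, ht, -, hh⟩ := exists_sub_mem_harmonics Z (le_refl f.totalDegree)
    exact Submodule.mem_sup.2 ⟨t, ht, f - t, hh, by abel⟩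

/-- The part t of f in T(Z) is replaced by t - g, where g vanishes on Z and cancels the component of
degree d of t; the degree drops and the induction continues. -/
theorem exists_sub_mem_vanishingIdeal {n : ℕ} (Z : Set (Fin n → ℚ)) (d : ℕ) :
    ∀ f : MvPolynomial (Fin n) ℚ, f.totalDegree < d →
      ∃ h ∈ harmonics Z, f - h ∈ MvPolynomial.vanishingIdeal ℚ Z := by
  induction d with
  | zero => exact fun f hf => absurd hf (Nat.not_lt_zero _)
  | succ d ih =>
    intro f hf
    obtain ⟨t, ht, htd, hh⟩ := exists_sub_mem_harmonics Z (Nat.lt_succ_iff.1 hf)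
    obtain ⟨g, hg, hgd, hgc⟩ := exists_vanishing_of_mem_idealT ht d
    -- Zero has total degree 0, so for d = 0 the strict drop in degree fails exactly here.
    by_cases h0 : t - g = 0
    · refine ⟨f - t, hh, ?_⟩
      rw [sub_sub_cancel, sub_eq_zero.1 h0]
      exact hg
    have hlt : (t - g).totalDegree < d := by
      have hle : (t - g).totalDegree ≤ d :=
        (MvPolynomial.totalDegree_sub _ _).trans (max_le htd hgd)
      refine lt_of_le_of_ne hle fun heq => h0 ?_
      have hc : MvPolynomial.homogeneousComponent d (t - g) = 0 := by
        rw [map_sub, hgc, sub_self]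
      by_contra hne
      obtain ⟨a, ha, hmax⟩ := Finset.exists_max_image (t - g).support (fun a => Finsupp.degree a)
        (MvPolynomial.support_nonempty.2 hne)
      have hda : Finsupp.degree a = d := by
        refine le_antisymm ((MvPolynomial.le_totalDegree ha).trans hle) ?_
        rw [← heq, MvPolynomial.totalDegree]
        exact Finset.sup_le hmax
      have := congrArg (MvPolynomial.coeff a) hc
      rw [MvPolynomial.coeff_homogeneousComponent, if_pos hda, MvPolynomial.coeff_zero] at this
      exact MvPolynomial.mem_support_iff.1 ha this
    obtain ⟨h', hh', hv⟩ := ih (t - g) hlt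
    refine ⟨f - t + h', add_mem hh hh', ?_⟩
    have : f - (f - t + h') = (t - g - h') + g := by abel
    rw [this]
    exact add_mem hv hg

theorem isCompl_vanishingIdeal_harmonics {n : ℕ} (Z : Set (Fin n → ℚ)) :
    IsCompl ((MvPolynomial.vanishingIdeal ℚ Z).restrictScalars ℚ) (harmonics Z) := by
  constructor
  · rw [Submodule.disjoint_def]
    intro f hf hh
    by_contra h0
    -- Pairing f with its own top component, which lies in T(Z), gives the norm of that component.
    have h1 := hh _ (homogeneousComponent_mem_idealT hf le_rfl)
    have h2 : coeffForm n (MvPolynomial.homogeneousComponent f.totalDegree f)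
        (MvPolynomial.homogeneousComponent f.totalDegree f) = 0 := by
      rw [← h1, coeffForm_apply, coeffForm_apply]
      refine Finset.sum_subset_zero_on_sdiff ?_ ?_ ?_
      · rw [MvPolynomial.support_homogeneousComponent]
        exact Finset.filter_subset _ _
      · intro a ha
        rw [MvPolynomial.notMem_support_iff.1 (Finset.mem_sdiff.1 ha).2, mul_zero]
      · intro a ha
        rw [MvPolynomial.support_homogeneousComponent] at ha
        congr 1
        rw [MvPolynomial.coeff_homogeneousComponent, if_pos (Finset.mem_filter.1 ha).2]
    have h3 := coeffForm_self_eq_zero h2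
    obtain ⟨a, ha, hmax⟩ := Finset.exists_max_image f.support (fun a => Finsupp.degree a)
      (MvPolynomial.support_nonempty.2 h0)
    have hda : Finsupp.degree a = f.totalDegree :=
      le_antisymm (MvPolynomial.le_totalDegree ha) (Finset.sup_le hmax)
    have := congrArg (MvPolynomial.coeff a) h3
    rw [MvPolynomial.coeff_homogeneousComponent, if_pos hda, MvPolynomial.coeff_zero] at this
    exact MvPolynomial.mem_support_iff.1 ha this
  · rw [codisjoint_iff, eq_top_iff]
    intro f _
    obtain ⟨h, hh, hv⟩ := exists_sub_mem_vanishingIdeal Z _ f (Nat.lt_succ_self _)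
    exact Submodule.mem_sup.2 ⟨f - h, hv, h, hh, by abel⟩

/-- Evaluation of polynomials at a family of points. -/
def evalAt {n : ℕ} {Ω : Type*} (z : Ω → Fin n → ℚ) : MvPolynomial (Fin n) ℚ →ₗ[ℚ] (Ω → ℚ) :=
  LinearMap.pi fun ω => (MvPolynomial.aeval (z ω)).toLinearMap

/-- Lagrange interpolation: a product of linear polynomials, one for each other point, is nonzero at
ω only. -/
theorem evalAt_surjective {n : ℕ} {Ω : Type*} [Finite Ω] {z : Ω → Fin n → ℚ}
    (hz : Function.Injective z) : Function.Surjective (evalAt z) := by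
  classical
  cases nonempty_fintype Ω
  have hind : ∀ ω, ∃ f : MvPolynomial (Fin n) ℚ, MvPolynomial.aeval (z ω) f ≠ 0 ∧
      ∀ ω', ω' ≠ ω → MvPolynomial.aeval (z ω') f = 0 := by
    intro ω
    have hlin : ∀ ω', ω' ≠ ω → ∃ g : MvPolynomial (Fin n) ℚ, MvPolynomial.aeval (z ω) g ≠ 0 ∧
        MvPolynomial.aeval (z ω') g = 0 := by
      intro ω' hω'
      obtain ⟨i, hi⟩ := Function.ne_iff.1 (hz.ne hω'.symm)
      refine ⟨MvPolynomial.X i - MvPolynomial.C (z ω' i), ?_, by simp⟩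
      simpa [sub_eq_zero] using hi
    choose! g hg hg' using hlin
    refine ⟨∏ ω' ∈ Finset.univ.erase ω, g ω', ?_, fun ω' hω' => ?_⟩
    · rw [map_prod, Finset.prod_ne_zero_iff]
      exact fun ω' hω' => hg ω' (Finset.ne_of_mem_erase hω')
    · rw [map_prod]
      exact Finset.prod_eq_zero (Finset.mem_erase.2 ⟨hω', Finset.mem_univ _⟩) (hg' ω' hω')
  choose f hf hf' using hind
  intro v
  refine ⟨∑ ω, (v ω / MvPolynomial.aeval (z ω) (f ω)) • f ω, funext fun ω => ?_⟩
  change MvPolynomial.aeval (z ω) _ = _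
  rw [map_sum, Finset.sum_eq_single ω]
  · rw [map_smul, smul_eq_mul, div_mul_cancel₀ _ (hf ω)]
  · intro ω' _ hne
    rw [map_smul, hf' ω' ω hne.symm, smul_zero]
  · exact fun h => absurd (Finset.mem_univ _) h

/-- The map is evaluation only on harmonic representatives: elements of T(Z) need not vanish on Z.
-/
theorem exists_quotient_equiv {n : ℕ} {Ω : Type*} [Finite Ω] {z : Ω → Fin n → ℚ}
    (hz : Function.Injective z) :
    ∃ e : (MvPolynomial (Fin n) ℚ ⧸ idealT (Set.range z)) ≃ₗ[ℚ] (Ω → ℚ),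
      ∀ h ∈ harmonics (Set.range z), e (Ideal.Quotient.mk _ h) = evalAt z h := by
  have hker : LinearMap.ker (evalAt z) =
      (MvPolynomial.vanishingIdeal ℚ (Set.range z)).restrictScalars ℚ := by
    ext f
    rw [LinearMap.mem_ker, funext_iff]
    exact (Set.forall_mem_range (p := fun x => MvPolynomial.aeval x f = 0)).symm
  have hc := isCompl_vanishingIdeal_harmonics (Set.range z)
  rw [← hker] at hc
  let e1 := Submodule.quotientEquivOfIsCompl _ _ (isCompl_idealT_harmonics (Set.range z))
  let e2 := Submodule.quotientEquivOfIsCompl _ _ hc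
  let e3 := (evalAt z).quotKerEquivOfSurjective (evalAt_surjective hz)
  refine ⟨(e1.trans e2.symm).trans e3, fun h hh => ?_⟩
  have h1 : e1 (Submodule.Quotient.mk h) = ⟨h, hh⟩ :=
    Submodule.quotientEquivOfIsCompl_apply_mk_right _ ⟨h, hh⟩
  change e3 (e2.symm (e1 (Submodule.Quotient.mk h))) = _
  rw [h1]
  rfl


/-! ### An injection from nonskip monomials to ordered set partitions

A batch structure on the positions is given by a function `b : ℕ → ℕ`, the position `p` lying in
the batch `b p`. -/

section Counting

variable (b : ℕ → ℕ) (k : ℕ)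

/-- The earlier positions in the batch of `m`. -/
def earlier (m : ℕ) : Finset ℕ :=
  (Finset.range m).filter fun q => b q = b m

/-- The recursive form of the nonskip condition on the first `m` exponents; `j` is the number of
blocks that have to be covered by the first `m` letters. -/
def GreedyNonskip : ℕ → ℕ → (ℕ → ℕ) → Prop
  | 0, j, _ => j = 0
  | m + 1, j, a => a m < k - (earlier b m).card ∧
      if a m + j ≤ k then GreedyNonskip m (j - 1) a else GreedyNonskip m j a

/-- The values in `Fin k` allowed for the letter `m`, after `z` has been fixed on the earlier
letters, when `j` values have to be covered at the end. -/
def allowedValues (m j : ℕ) (z : ℕ → Fin k) : Finset (Fin k) :=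
  if ((Finset.range m).image z).card < j then ((Finset.range m).image z)ᶜ
  else ((earlier b m).image z)ᶜ

/-- The `a`-th element of a finite set, or a default value. -/
def nthElement {k : ℕ} (s : Finset (Fin k)) (a : ℕ) (dflt : Fin k) : Fin k :=
  if h : a < s.card then s.orderEmbOfFin rfl ⟨a, h⟩ else dflt

theorem nthElement_mem {k : ℕ} {s : Finset (Fin k)} {a : ℕ} (h : a < s.card) (dflt : Fin k) :
    nthElement s a dflt ∈ s := by
  rw [nthElement, dif_pos h]
  exact Finset.orderEmbOfFin_mem _ _ _

theorem nthElement_inj {k : ℕ} {s : Finset (Fin k)} {a a' : ℕ} (h : a < s.card)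
    (h' : a' < s.card) {dflt : Fin k} (he : nthElement s a dflt = nthElement s a' dflt) :
    a = a' := by
  rw [nthElement, nthElement, dif_pos h, dif_pos h'] at he
  exact congrArg Fin.val ((s.orderEmbOfFin rfl).injective he)

variable {k} in
/-- The insertion map from exponents to words in `Fin k`. -/
def insertionWord (dflt : Fin k) : ℕ → ℕ → (ℕ → ℕ) → ℕ → Fin k
  | 0, _, _ => fun _ => dflt
  | m + 1, j, a =>
      let z := if a m + j ≤ k then insertionWord dflt m (j - 1) a else insertionWord dflt m j a
      Function.update z m (nthElement (allowedValues b k m j z) (a m) dflt)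

variable {k} in
/-- The words whose first `m` letters are distinct within batches and take at least `j` values. -/
def CoveringWord (m j : ℕ) (z : ℕ → Fin k) : Prop :=
  (∀ p q, p < q → q < m → b p = b q → z p ≠ z q) ∧ j ≤ ((Finset.range m).image z).card

variable {b k}

theorem CoveringWord.mono {m j j' : ℕ} (h : j' ≤ j) {z : ℕ → Fin k} (hz : CoveringWord b m j z) :
    CoveringWord b m j' z :=
  ⟨hz.1, h.trans hz.2⟩

/-- If fewer than j values are used, the letter must take a new one. Then the case `a + j ≤ k`
holds, and at least k - (j - 1) > a new values exist. Otherwise only the values used earlier in the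
batch are forbidden. -/
theorem lt_card_allowedValues {m j : ℕ} {z : ℕ → Fin k} {a : ℕ}
    (ha : a < k - (earlier b m).card)
    (hz : if a + j ≤ k then CoveringWord b m (j - 1) z else CoveringWord b m j z) :
    a < (allowedValues b k m j z).card := by
  rw [allowedValues]
  have h2 : ((earlier b m).image z).card ≤ (earlier b m).card := Finset.card_image_le
  by_cases h1 : ((Finset.range m).image z).card < j
  · rw [if_pos h1, Finset.card_compl, Fintype.card_fin]
    by_cases h3 : a + j ≤ k
    · omega
    · rw [if_neg h3] at hz
      exact absurd hz.2 (not_le.2 h1)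
  · rw [if_neg h1, Finset.card_compl, Fintype.card_fin]
    omega

theorem allowedValues_subset (m j : ℕ) (z : ℕ → Fin k) :
    allowedValues b k m j z ⊆ ((earlier b m).image z)ᶜ := by
  rw [allowedValues]
  split_ifs
  · exact Finset.compl_subset_compl.2 (Finset.image_subset_image (Finset.filter_subset _ _))
  · exact subset_rfl

theorem coveringWord_update {m j : ℕ} {z : ℕ → Fin k} (hz : CoveringWord b m (j - 1) z) {v : Fin k}
    (hv : v ∈ allowedValues b k m j z) :
    CoveringWord b (m + 1) j (Function.update z m v) := by
  have himg : (Finset.range (m + 1)).image (Function.update z m v) =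
      insert v ((Finset.range m).image z) := by
    rw [Finset.range_add_one, Finset.image_insert, Function.update_self]
    congr 1
    refine Finset.image_congr fun p hp => ?_
    rw [Function.update_of_ne (Finset.mem_range.1 hp).ne]
  constructor
  · intro p q hpq hq hb
    rcases (Nat.lt_succ_iff.1 hq).lt_or_eq with h | rfl
    · rw [Function.update_of_ne h.ne, Function.update_of_ne (hpq.trans h).ne]
      exact hz.1 p q hpq h hb
    · rw [Function.update_self, Function.update_of_ne hpq.ne]
      rintro rfl
      have := allowedValues_subset _ _ _ hv
      rw [Finset.mem_compl] at this
      exact this (Finset.mem_image_of_mem _ (Finset.mem_filter.2 ⟨Finset.mem_range.2 hpq, hb⟩))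
  · rw [himg]
    by_cases h : ((Finset.range m).image z).card < j
    · rw [allowedValues, if_pos h, Finset.mem_compl] at hv
      rw [Finset.card_insert_of_notMem hv]
      have := hz.2
      omega
    · exact (not_lt.1 h).trans (Finset.card_le_card (Finset.subset_insert _ _))

theorem coveringWord_insertionWord (dflt : Fin k) {m j : ℕ} {a : ℕ → ℕ}
    (ha : GreedyNonskip b k m j a) : CoveringWord b m j (insertionWord b dflt m j a) := by
  induction m generalizing j with
  | zero =>
    change j = 0 at ha
    subst ha
    exact ⟨fun _ _ _ h => absurd h (Nat.not_lt_zero _), Nat.zero_le _⟩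
  | succ m ih =>
    obtain ⟨h1, h2⟩ := ha
    simp only [insertionWord]
    split_ifs at h2 ⊢ with h
    · exact coveringWord_update (ih h2)
        (nthElement_mem (lt_card_allowedValues h1 (by rw [if_pos h]; exact ih h2)) _)
    · exact coveringWord_update ((ih h2).mono (Nat.sub_le _ _))
        (nthElement_mem (lt_card_allowedValues h1 (by rw [if_neg h]; exact ih h2)) _)

theorem allowedValues_congr {m j : ℕ} {z z' : ℕ → Fin k} (h : ∀ p < m, z p = z' p) :
    allowedValues b k m j z = allowedValues b k m j z' := by
  have h1 : (Finset.range m).image z = (Finset.range m).image z' :=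
    Finset.image_congr fun p hp => h p (Finset.mem_range.1 hp)
  have h2 : (earlier b m).image z = (earlier b m).image z' :=
    Finset.image_congr fun p hp => h p (Finset.mem_range.1 (Finset.mem_filter.1 hp).1)
  rw [allowedValues, allowedValues, h1, h2]

theorem nthElement_congr {k : ℕ} {s s' : Finset (Fin k)} (h : s = s') {a a' : ℕ} (hs : a < s.card)
    (hs' : a' < s'.card) {dflt : Fin k} (he : nthElement s a dflt = nthElement s' a' dflt) :
    a = a' := by
  subst h
  exact nthElement_inj hs hs' he

/-- Decoding runs from the last letter: the earlier letters and j determine the allowed values, so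
the value of letter m reveals a m. This fixes the branch taken and hence the j for the first m
letters. -/
theorem insertionWord_injective (dflt : Fin k) {m j : ℕ} {a a' : ℕ → ℕ}
    (ha : GreedyNonskip b k m j a) (ha' : GreedyNonskip b k m j a')
    (h : ∀ p < m, insertionWord b dflt m j a p = insertionWord b dflt m j a' p) :
    ∀ p < m, a p = a' p := by
  induction m generalizing j with
  | zero => exact fun p hp => absurd hp (Nat.not_lt_zero _)
  | succ m ih =>
    obtain ⟨h1, h2⟩ := ha
    obtain ⟨h1', h2'⟩ := ha'
    simp only [insertionWord] at h
    set z := if a m + j ≤ k then insertionWord b dflt m (j - 1) a else insertionWord b dflt m j a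
      with hz
    set z' := if a' m + j ≤ k then insertionWord b dflt m (j - 1) a'
      else insertionWord b dflt m j a' with hz'
    have hzz : ∀ p < m, z p = z' p := fun p hp => by
      have := h p (hp.trans (Nat.lt_succ_self m))
      rwa [Function.update_of_ne hp.ne, Function.update_of_ne hp.ne] at this
    have hcov : if a m + j ≤ k then CoveringWord b m (j - 1) z else CoveringWord b m j z := by
      rw [hz]
      split_ifs at h2 ⊢ <;> exact coveringWord_insertionWord dflt h2
    have hcov' : if a' m + j ≤ k then CoveringWord b m (j - 1) z' else CoveringWord b m j z' := by
      rw [hz']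
      split_ifs at h2' ⊢ <;> exact coveringWord_insertionWord dflt h2'
    have hm := h m (Nat.lt_succ_self m)
    rw [Function.update_self, Function.update_self] at hm
    have ham : a m = a' m := nthElement_congr (allowedValues_congr hzz)
      (lt_card_allowedValues h1 hcov) (lt_card_allowedValues h1' hcov') hm
    have hrest : ∀ p < m, a p = a' p := by
      rw [← ham] at h2' hz'
      split_ifs at h2 h2' hz hz'
      · exact ih h2 h2' (by rwa [hz, hz'] at hzz)
      · exact ih h2 h2' (by rwa [hz, hz'] at hzz)
    intro p hp
    rcases (Nat.lt_succ_iff.1 hp).lt_or_eq with hp | rfl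
    · exact hrest p hp
    · exact ham

/-- T collects the positions p that fail to lower the count, that is with a p + j_p > k, where j_p
is j minus the number of positions after p that lowered it. Reading stops once the count exceeds the
number of remaining positions by one. -/
theorem exists_skip_of_not_greedyNonskip {m j : ℕ} {a : ℕ → ℕ} (hj : j ≤ m + 1) (hjk : j ≤ k)
    (hb : ∀ p < m, a p < k - (earlier b p).card) (ha : ¬ GreedyNonskip b k m j a) :
    ∃ T ⊆ Finset.range m, T.card + j = m + 1 ∧
      ∀ p ∈ T, k - j + ((Finset.Ioo p m).filter fun q => q ∉ T).card + 1 ≤ a p := by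
  induction m generalizing j with
  | zero =>
    have hj0 : j ≠ 0 := ha
    exact ⟨∅, by simp, by rw [Finset.card_empty]; omega, by simp⟩
  | succ m ih =>
    rcases hj.eq_or_lt with rfl | hj
    · exact ⟨∅, by simp, by rw [Finset.card_empty, zero_add], by simp⟩
    have hb' : ∀ p < m, a p < k - (earlier b p).card := fun p hp =>
      hb p (hp.trans (Nat.lt_succ_self m))
    have hrange : Finset.range m ⊆ Finset.range (m + 1) :=
      Finset.range_subset_range.2 (Nat.le_succ m)
    have hIoo : ∀ p < m, Finset.Ioo p (m + 1) = insert m (Finset.Ioo p m) := fun p hp => by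
      ext q
      simp only [Finset.mem_Ioo, Finset.mem_insert]
      omega
    by_cases h : a m + j ≤ k
    · have ha' : ¬ GreedyNonskip b k m (j - 1) a := fun hg =>
        ha ⟨hb m (Nat.lt_succ_self m), by rwa [if_pos h]⟩
      obtain ⟨T, hT, hcard, hle⟩ := ih (by omega) (by omega) hb' ha'
      -- This forces j - 1 ≥ 1, so the truncated subtraction is a true one.
      have hTm := Finset.card_le_card hT
      rw [Finset.card_range] at hTm
      have hmT : m ∉ T := fun hm => absurd (Finset.mem_range.1 (hT hm)) (lt_irrefl m)
      refine ⟨T, hT.trans hrange, by omega, fun p hp => ?_⟩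
      have := hle p hp
      rw [hIoo p (Finset.mem_range.1 (hT hp)), Finset.filter_insert, if_pos hmT,
        Finset.card_insert_of_notMem (by simp)]
      omega
    · have ha' : ¬ GreedyNonskip b k m j a := fun hg =>
        ha ⟨hb m (Nat.lt_succ_self m), by rwa [if_neg h]⟩
      obtain ⟨T, hT, hcard, hle⟩ := ih (by omega) hjk hb' ha'
      have hmT : m ∉ T := fun hm => absurd (Finset.mem_range.1 (hT hm)) (lt_irrefl m)
      refine ⟨insert m T, ?_, ?_, fun p hp => ?_⟩
      · exact Finset.insert_subset (Finset.mem_range.2 (Nat.lt_succ_self m)) (hT.trans hrange)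
      · rw [Finset.card_insert_of_notMem hmT]
        omega
      · rcases Finset.mem_insert.1 hp with rfl | hp
        · have : Finset.Ioo p (p + 1) = ∅ := by
            ext q
            simp only [Finset.mem_Ioo, Finset.notMem_empty, iff_false]
            omega
          rw [this, Finset.filter_empty, Finset.card_empty]
          omega
        · rw [hIoo p (Finset.mem_range.1 (hT hp)), Finset.filter_insert,
            if_neg (by simp)]
          refine le_trans ?_ (hle p hp)
          have := Finset.card_le_card (Finset.monotone_filter_right (Finset.Ioo p m)
            (p := fun q => q ∉ insert m T) (q := fun q => q ∉ T)
            fun q _ hn h' => hn (Finset.mem_insert_of_mem h'))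
          omega

end Counting


/-! ### Ordered set partitions as words and as points -/

namespace OP

variable {n r k : ℕ} {α : Fin r → ℕ}

/-- The index of the block that contains a letter. -/
def index (σ : OP n α k) (p : Fin n) : Fin k :=
  (σ.cover p).choose

theorem mem_block_iff (σ : OP n α k) (p : Fin n) (j : Fin k) : p ∈ σ.block j ↔ σ.index p = j := by
  have h : p ∈ σ.block (σ.index p) := (σ.cover p).choose_spec
  constructor
  · intro hj
    by_contra hne
    exact Finset.disjoint_left.1 (σ.disjoint _ _ hne) h hj
  · rintro rfl
    exact h

theorem index_injective : Function.Injective (index : OP n α k → Fin n → Fin k) := by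
  intro σ τ h
  refine OP.ext (funext fun j => Finset.ext fun p => ?_)
  rw [mem_block_iff, mem_block_iff, h]

instance : Finite (OP n α k) := Finite.of_injective _ index_injective

theorem index_surjective (σ : OP n α k) : Function.Surjective σ.index := by
  intro j
  obtain ⟨p, hp⟩ := σ.nonempty j
  exact ⟨p, (σ.mem_block_iff p j).1 hp⟩

theorem index_injOn (σ : OP n α k) (i : Fin r) : Set.InjOn σ.index (batch n α i) := by
  intro p hp q hq h
  by_contra hne
  exact σ.distinct i p hp q hq hne (σ.index q)
    ⟨(σ.mem_block_iff p _).2 h, (σ.mem_block_iff q _).2 rfl⟩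

/-- The ordered set partition whose blocks are the fibres of a word. -/
def ofWord (z : Fin n → Fin k) (hz : Function.Surjective z)
    (hinj : ∀ i, Set.InjOn z (batch n α i)) : OP n α k where
  block j := Finset.univ.filter fun p => z p = j
  nonempty j := by
    obtain ⟨p, hp⟩ := hz j
    exact ⟨p, Finset.mem_filter.2 ⟨Finset.mem_univ p, hp⟩⟩
  disjoint j l h := by
    rw [Finset.disjoint_left]
    intro p hp hp'
    exact h ((Finset.mem_filter.1 hp).2.symm.trans (Finset.mem_filter.1 hp').2)
  cover p := ⟨z p, Finset.mem_filter.2 ⟨Finset.mem_univ p, rfl⟩⟩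
  distinct i p hp q hq hne j h :=
    hne (hinj i hp hq ((Finset.mem_filter.1 h.1).2.trans (Finset.mem_filter.1 h.2).2.symm))

theorem index_ofWord (z : Fin n → Fin k) (hz : Function.Surjective z)
    (hinj : ∀ i, Set.InjOn z (batch n α i)) : (ofWord z hz hinj).index = z :=
  funext fun p => ((ofWord z hz hinj).mem_block_iff p (z p)).1
    (Finset.mem_filter.2 ⟨Finset.mem_univ p, rfl⟩)

theorem index_smul (π : parabolic n α) (σ : OP n α k) (p : Fin n) :
    (π • σ).index ((π : Equiv.Perm (Fin n)) p) = σ.index p := by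
  rw [← mem_block_iff]
  change _ ∈ (σ.block _).map _
  rw [Finset.mem_map_equiv, Equiv.symm_apply_apply, mem_block_iff]

/-- The point of `ℚⁿ` attached to an ordered set partition. -/
def point (η : Fin k → ℚ) (σ : OP n α k) : Fin n → ℚ :=
  fun p => η (σ.index p)

theorem point_injective {η : Fin k → ℚ} (hη : Function.Injective η) :
    Function.Injective (point η : OP n α k → Fin n → ℚ) :=
  fun _ _ h => index_injective (funext fun p => hη (congrFun h p))

theorem range_point {η : Fin k → ℚ} (hη : Function.Injective η) :
    Set.range (point η : OP n α k → Fin n → ℚ) = locus n α η := by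
  ext z
  constructor
  · rintro ⟨σ, rfl⟩
    refine ⟨σ.index_surjective.range_comp η, fun i p hp q hq h => ?_⟩
    exact σ.index_injOn i hp hq (hη h)
  · rintro ⟨hz, hinj⟩
    have hsec : ∀ p, ∃ l, η l = z p := fun p => by
      have : z p ∈ Set.range η := hz ▸ Set.mem_range_self p
      exact this
    choose w hw using hsec
    have hsurj : Function.Surjective w := fun j => by
      have : η j ∈ Set.range z := hz ▸ Set.mem_range_self j
      obtain ⟨p, hp⟩ := this
      exact ⟨p, hη (by rw [hw, hp])⟩
    have hwinj : ∀ i, Set.InjOn w (batch n α i) := fun i p hp q hq h =>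
      hinj i hp hq (by rw [← hw, ← hw, h])
    refine ⟨ofWord w hsurj hwinj, funext fun p => ?_⟩
    rw [point, index_ofWord, hw]

end OP

/-! ### Counting nonskip monomials -/

section NonskipCount

variable {n r k : ℕ} {α : Fin r → ℕ}

/-- Extension of an exponent vector by zero. -/
def extendExponents (a : Fin n →₀ ℕ) (p : ℕ) : ℕ :=
  if h : p < n then a ⟨p, h⟩ else 0

/-- An entry i - j + 1 of the skip sequence is one more than the number of gaps before s_j;
reversing the positions turns these into the gaps after p. -/
theorem revSkipMonomial_le_of_skip {a : Fin n →₀ ℕ} {T : Finset ℕ} (hT : T ⊆ Finset.range n)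
    (h : ∀ p ∈ T, ((Finset.Ioo p n).filter fun q => q ∉ T).card + 1 ≤ extendExponents a p) :
    ∃ S : Finset (Fin n), S.card = T.card ∧ revSkipMonomial S ≤ a := by
  let e : Fin n ↪ ℕ := Fin.revPerm.toEmbedding.trans Fin.valEmbedding
  have he : ∀ s : Fin n, e s = (Fin.rev s : ℕ) := fun s => rfl
  have hmap : ∀ U ⊆ Finset.range n, (Finset.univ.filter fun s => e s ∈ U).map e = U := by
    intro U hU
    ext t
    simp only [Finset.mem_map, Finset.mem_filter, Finset.mem_univ, true_and]
    constructor
    · rintro ⟨s, hs, rfl⟩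
      exact hs
    · intro ht
      have : e (Fin.rev ⟨t, Finset.mem_range.1 (hU ht)⟩) = t := by
        rw [he, Fin.rev_rev]
      exact ⟨_, by rwa [this], this⟩
  refine ⟨Finset.univ.filter fun s => e s ∈ T, ?_, fun p => ?_⟩
  · rw [← Finset.card_map e, hmap T hT]
  change skipSeq _ (Fin.rev p) ≤ a p
  rw [skipSeq]
  split_ifs with hp
  · have hpT : (p : ℕ) ∈ T := by
      have := (Finset.mem_filter.1 hp).2
      rwa [he, Fin.rev_rev] at this
    have hle := h p hpT
    rw [extendExponents, dif_pos p.2] at hle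
    refine le_trans ?_ hle
    have hfilter : ((Finset.univ.filter fun s => e s ∈ T).filter fun q => q ≤ Fin.rev p) =
        Finset.univ.filter fun s => e s ∈ T.filter fun t => (p : ℕ) ≤ t := by
      ext s
      simp only [Finset.mem_filter, Finset.mem_univ, true_and, he, and_congr_right_iff]
      intro _
      rw [Fin.le_rev_iff, Fin.le_def]
    rw [hfilter, ← Finset.card_map e, hmap _ ((Finset.filter_subset _ _).trans hT)]
    have hcover : Finset.Ico (p : ℕ) n ⊆ ((Finset.Ioo (p : ℕ) n).filter fun q => q ∉ T) ∪
        T.filter fun t => (p : ℕ) ≤ t := by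
      intro q hq
      rw [Finset.mem_Ico] at hq
      rw [Finset.mem_union, Finset.mem_filter, Finset.mem_filter, Finset.mem_Ioo]
      by_cases hqT : q ∈ T
      · exact Or.inr ⟨hqT, hq.1⟩
      · refine Or.inl ⟨⟨lt_of_le_of_ne hq.1 ?_, hq.2⟩, hqT⟩
        rintro rfl
        exact hqT hpT
    have := (Finset.card_le_card hcover).trans (Finset.card_union_le _ _)
    rw [Nat.card_Ico] at this
    have hrev : ((Fin.rev p : Fin n) : ℕ) + 1 = n - p := by
      rw [Fin.val_rev]
      omega
    rw [hrev]
    omega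
  · exact Nat.zero_le _

theorem exists_injective_nonskip (hk : 0 < k) (hkn : k ≤ n + 1) (hα : ∀ i, 1 ≤ α i ∧ α i ≤ k)
    (hn : ∑ i, α i = n) : ∃ f : nonskip n α k → OP n α k, Function.Injective f := by
  choose β hβ using exists_mem_batch hn
  let b : ℕ → ℕ := fun p => if h : p < n then (β ⟨p, h⟩ : ℕ) else 0
  have hb : ∀ p : Fin n, b p = β p := fun p => dif_pos p.2
  have hβ' : ∀ p, batchStart α (β p) ≤ (p : ℕ) ∧ (p : ℕ) < batchStart α (β p) + α (β p) :=
    fun p => (Finset.mem_filter.1 (hβ p)).2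
  have hβu : ∀ i p, p ∈ batch n α i → β p = i := by
    intro i p hp
    have h1 := (Finset.mem_filter.1 hp).2
    have h2 := hβ' p
    rcases lt_trichotomy (β p) i with h | h | h
    · have := batchStart_add_le_of_lt α h
      omega
    · exact h
    · have := batchStart_add_le_of_lt α h
      omega
  have hearlier : ∀ p : Fin n, (earlier b p).card ≤ p - batchStart α (β p) := by
    intro p
    rw [← Nat.card_Ico]
    refine Finset.card_le_card fun q hq => ?_
    obtain ⟨hq, hbq⟩ := Finset.mem_filter.1 hq
    rw [Finset.mem_range] at hq
    have h1 := hb ⟨q, hq.trans p.2⟩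
    rw [Finset.mem_Ico]
    refine ⟨?_, hq⟩
    have h2 : β ⟨q, hq.trans p.2⟩ = β p := Fin.ext (by rw [← h1, ← hb p, ← hbq])
    rw [← h2]
    exact (hβ' ⟨q, _⟩).1
  have hgreedy : ∀ a ∈ nonskip n α k, GreedyNonskip b k n k (extendExponents a) := by
    intro a ha
    by_contra hg
    obtain ⟨T, hT, hcard, hle⟩ := exists_skip_of_not_greedyNonskip hkn le_rfl (fun p hp => by
      rw [extendExponents, dif_pos hp]
      have h1 := hβ' ⟨p, hp⟩
      have h2 := hearlier ⟨p, hp⟩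
      -- The rank of p in its batch; at most rank - 1 earlier positions share the batch.
      have h3 := ha.2 (β ⟨p, hp⟩) (p - batchStart α (β ⟨p, hp⟩) + 1) (by omega)
        (by simp only at h1; omega) ⟨p, hp⟩ (by simp only at h1 ⊢; omega)
      have h4 := (hα (β ⟨p, hp⟩)).2
      simp only at h1 h2
      omega) hg
    obtain ⟨S, hS, hSa⟩ := revSkipMonomial_le_of_skip hT (a := a) fun p hp => by
      have := hle p hp
      omega
    exact ha.1 S (by omega) hSa
  let dflt : Fin k := ⟨0, hk⟩
  have hword : ∀ a : nonskip n α k, ∃ σ : OP n α k,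
      ∀ p, σ.index p = insertionWord b dflt n k (extendExponents a.1) p := by
    intro a
    have hc := coveringWord_insertionWord dflt (hgreedy a a.2)
    set w := insertionWord b dflt n k (extendExponents a.1) with hw
    have himg : (Finset.range n).image w = Finset.univ := by
      refine Finset.eq_univ_of_card _ (le_antisymm (Finset.card_le_univ _) ?_)
      rw [Fintype.card_fin]
      exact hc.2
    have hsurj : Function.Surjective fun p : Fin n => w p := fun j => by
      have := Finset.mem_univ j
      rw [← himg, Finset.mem_image] at this
      obtain ⟨p, hp, hpj⟩ := this
      exact ⟨⟨p, Finset.mem_range.1 hp⟩, hpj⟩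
    have hwinj : ∀ i, Set.InjOn (fun p : Fin n => w p) (batch n α i) := fun i p hp q hq h => by
      have hbb : b p = b q := by
        rw [hb, hb, hβu i p hp, hβu i q hq]
      rcases lt_trichotomy p q with hlt | heq | hlt
      · exact absurd h (hc.1 p q hlt q.2 hbb)
      · exact heq
      · exact absurd h.symm (hc.1 q p hlt p.2 hbb.symm)
    exact ⟨OP.ofWord _ hsurj hwinj, fun p => congrFun (OP.index_ofWord _ hsurj hwinj) p⟩
  choose f hf using hword
  refine ⟨f, fun a a' h => ?_⟩
  have := insertionWord_injective dflt (hgreedy a a.2) (hgreedy a' a'.2) fun p hp => by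
    rw [← hf a ⟨p, hp⟩, ← hf a' ⟨p, hp⟩, h]
  refine Subtype.ext (Finsupp.ext fun p => ?_)
  have := this p p.2
  rwa [extendExponents, extendExponents, dif_pos p.2, dif_pos p.2] at this

end NonskipCount


/-! ### Leading monomials in `J_{α,k}` -/

open scoped MonomialOrder

theorem coeff_hSym_X {n : ℕ} (B : Finset (Fin n)) (d : ℕ) (a : Fin n →₀ ℕ) :
    (hSym (MvPolynomial.X (R := ℚ)) B d).coeff a = if a ∈ B.finsuppAntidiag d then 1 else 0 := by
  rw [hSym_X_eq_sum, MvPolynomial.coeff_sum]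
  simp_rw [MvPolynomial.coeff_monomial]
  exact Finset.sum_ite_eq' _ _ _

theorem degree_eq_of_coeff {n : ℕ} {f : MvPolynomial (Fin n) ℚ} {a : Fin n →₀ ℕ}
    (h : f.coeff a = 1) (hle : ∀ b ∈ f.support, b ≼[neglex n] a) :
    (neglex n).degree f = a ∧ (neglex n).Monic f := by
  have hd : (neglex n).degree f = a := by
    refine (neglex n).toSyn.injective (le_antisymm ?_ ?_)
    · exact (neglex n).degree_le_iff.2 hle
    · exact (neglex n).le_degree (MvPolynomial.mem_support_iff.2 (by rw [h]; exact one_ne_zero))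
  refine ⟨hd, ?_⟩
  rw [MonomialOrder.Monic, MonomialOrder.leadingCoeff, hd, h]

/-- All monomials of degree d in the variables of B occur with coefficient 1, and x_q is the largest
of these variables in `neglex`. -/
theorem hSym_X_degree {n : ℕ} {B : Finset (Fin n)} {q : Fin n} (hq : q ∈ B) (hB : ∀ p ∈ B, p ≤ q)
    (d : ℕ) : (neglex n).degree (hSym (MvPolynomial.X (R := ℚ)) B d) = Finsupp.single q d ∧
      (neglex n).Monic (hSym (MvPolynomial.X (R := ℚ)) B d) := by
  refine degree_eq_of_coeff ?_ fun a ha => ?_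
  · rw [coeff_hSym_X, if_pos]
    rw [Finset.mem_finsuppAntidiag']
    refine ⟨by simp, ?_⟩
    exact Finsupp.support_single_subset.trans (Finset.singleton_subset_iff.2 hq)
  · rw [MvPolynomial.mem_support_iff, coeff_hSym_X, ite_ne_right_iff,
      Finset.mem_finsuppAntidiag] at ha
    obtain ⟨⟨hsum, hsupp⟩, -⟩ := ha
    have haq : a q ≤ d := hsum ▸ Finset.single_le_sum (fun i _ => Nat.zero_le (a i)) hq
    rcases haq.lt_or_eq with h | h
    · refine le_of_lt ((neglex_lt_iff _ _).2 ⟨q, by simpa using h, fun j hj => ?_⟩)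
      rw [Finsupp.single_eq_of_ne hj.ne']
      by_contra hne
      exact absurd (hB j (hsupp (Finsupp.mem_support_iff.2 hne))) (not_le.2 hj)
    · have : a = Finsupp.single q d := by
        ext p
        by_cases hp : p = q
        · subst hp
          rw [h, Finsupp.single_eq_same]
        · rw [Finsupp.single_eq_of_ne hp]
          by_contra hne
          have hpB := hsupp (Finsupp.mem_support_iff.2 hne)
          have := Finset.sum_le_sum_of_subset (f := a)
            (Finset.insert_subset hpB (Finset.singleton_subset_iff.2 hq))
          rw [Finset.sum_pair hp, hsum, h] at this
          omega
      rw [this]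

theorem exists_degree_eq_of_degree_le {n : ℕ} {I : Ideal (MvPolynomial (Fin n) ℚ)}
    {f : MvPolynomial (Fin n) ℚ} (hf : f ∈ I) (h0 : f ≠ 0) {a : Fin n →₀ ℕ}
    (ha : (neglex n).degree f ≤ a) : ∃ g ∈ I, g ≠ 0 ∧ (neglex n).degree g = a := by
  have hm : MvPolynomial.monomial (a - (neglex n).degree f) (1 : ℚ) ≠ 0 := by
    rw [Ne, MvPolynomial.monomial_eq_zero]
    exact one_ne_zero
  refine ⟨_, I.mul_mem_left (MvPolynomial.monomial (a - (neglex n).degree f) 1) hf,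
    mul_ne_zero hm h0, ?_⟩
  classical
  rw [MonomialOrder.degree_mul hm h0, MonomialOrder.degree_monomial, if_neg one_ne_zero,
    tsub_add_cancel_of_le ha]

/-! #### The batch generators -/

/-- The first `j` letters of a batch. -/
def batchPrefix (n : ℕ) {r : ℕ} (α : Fin r → ℕ) (i : Fin r) (j : ℕ) : Finset (Fin n) :=
  Finset.univ.filter fun p => batchStart α i ≤ (p : ℕ) ∧ (p : ℕ) < batchStart α i + j

/-- Letters are removed from the end of the batch using h_{d+1}(B) = h_{d+1}(B ∪ p) - x_p h_d(B ∪
p); each removal raises the lowest available degree by one. -/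
theorem hSym_batchPrefix_mem_idealJ {n r k : ℕ} {α : Fin r → ℕ} (hn : ∑ i, α i = n) {i : Fin r}
    (hi : α i ≤ k) (c : ℕ) : ∀ j d, j + c = α i → k + 1 ≤ d + j → d ≤ k →
      hSym (MvPolynomial.X (R := ℚ)) (batchPrefix n α i j) d ∈ idealJ n α k := by
  induction c with
  | zero =>
    intro j d hj h1 h2
    rw [add_zero] at hj
    subst hj
    rw [← hsymmOn_eq_hSym]
    exact Ideal.subset_span (Or.inr ⟨i, d, h1, h2, rfl⟩)
  | succ c ih =>
    intro j d hj h1 h2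
    have hle := batchStart_add_le α i
    rw [hn] at hle
    obtain ⟨d, rfl⟩ : ∃ e, d = e + 1 := ⟨d - 1, by omega⟩
    let p : Fin n := ⟨batchStart α i + j, by omega⟩
    have hins : batchPrefix n α i (j + 1) = insert p (batchPrefix n α i j) := by
      ext q
      simp only [batchPrefix, Finset.mem_filter, Finset.mem_univ, true_and, Finset.mem_insert,
        p, Fin.ext_iff]
      omega
    have hp : p ∉ batchPrefix n α i j := by
      simp [batchPrefix, p]
    have h3 := ih (j + 1) (d + 1) (by omega) (by omega) h2
    have h4 := ih (j + 1) d (by omega) (by omega) (by omega)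
    rw [hins] at h3 h4
    rw [hSym_insert_succ _ _ hp] at h3
    exact (Submodule.add_mem_iff_left _ (Ideal.mul_mem_left _ _ h4)).1 h3

theorem exists_degree_eq_single {n r k : ℕ} {α : Fin r → ℕ} (hn : ∑ i, α i = n) {i : Fin r}
    (hi : α i ≤ k) {j : ℕ} (h1 : 1 ≤ j) (h2 : j ≤ α i) {p : Fin n}
    (hp : (p : ℕ) + 1 = batchStart α i + j) :
    ∃ f ∈ idealJ n α k, f ≠ 0 ∧ (neglex n).degree f = Finsupp.single p (k - j + 1) := by
  have hd := hSym_X_degree (B := batchPrefix n α i j) (q := p)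
    (by simp only [batchPrefix, Finset.mem_filter, Finset.mem_univ, true_and]; omega)
    (fun q hq => by
      simp only [batchPrefix, Finset.mem_filter, Finset.mem_univ, true_and] at hq
      rw [Fin.le_def]
      omega) (k - j + 1)
  exact ⟨_, hSym_batchPrefix_mem_idealJ hn hi (α i - j) j (k - j + 1) (by omega) (by omega)
    (by omega), hd.2.ne_zero, hd.1⟩

/-! #### The skip monomials -/

theorem eSym_mem_idealJ {n r : ℕ} (α : Fin r → ℕ) {k d : ℕ} (h : n + 1 ≤ d + k) :
    eSym (MvPolynomial.X (R := ℚ)) (Finset.univ : Finset (Fin n)) d ∈ idealJ n α k := by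
  by_cases hd : d ≤ n
  · exact Ideal.subset_span (Or.inl ⟨d, h, hd, rfl⟩)
  · rw [eSym_eq_zero _ _ (by rw [Finset.card_univ, Fintype.card_fin]; omega)]
    exact zero_mem _

/-- The flagged Jacobi–Trudi matrix attached to a sequence `s` of letters. -/
def flaggedMatrix {n m : ℕ} (s : Fin m → Fin n) :
    Matrix (Fin m) (Fin m) (MvPolynomial (Fin n) ℚ) :=
  Matrix.of fun i j =>
    if (j : ℕ) ≤ s i + 1 then hSym MvPolynomial.X (Finset.Iic (Fin.rev (s i))) (s i + 1 - j) else 0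

/-- The untruncated row sum is zero by the e–h identity, as n - s_i variables and degree s_i + 1
exceed n together. The missing terms contain e_j with j ≥ m = n - k + 1. -/
theorem flaggedMatrix_mulVec_mem_idealJ {n r k m : ℕ} (α : Fin r → ℕ) (hm : m + k = n + 1)
    (s : Fin m → Fin n) (i : Fin m) :
    (flaggedMatrix s).mulVec (fun j => (-1) ^ (j : ℕ) * eSym MvPolynomial.X Finset.univ (j : ℕ)) i ∈
      idealJ n α k := by
  have hsum := sum_eSym_mul_hSym_eq_zero (MvPolynomial.X (R := ℚ))
    (Finset.subset_univ (Finset.Iic (Fin.rev (s i)))) (d := s i + 1) (by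
      rw [Finset.card_univ, Fintype.card_fin, Fin.card_Iic, Fin.val_rev]
      omega)
  rw [Finset.Nat.sum_antidiagonal_eq_sum_range_succ_mk] at hsum
  let G : ℕ → MvPolynomial (Fin n) ℚ := fun j =>
    (if j ≤ s i + 1 then hSym MvPolynomial.X (Finset.Iic (Fin.rev (s i))) (s i + 1 - j) else 0) *
      ((-1) ^ j * eSym MvPolynomial.X Finset.univ j)
  have hG0 : ∑ j ∈ Finset.range (s i + 2), G j = 0 := by
    rw [← hsum]
    refine Finset.sum_congr rfl fun j hj => ?_
    rw [Finset.mem_range] at hj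
    simp only [G]
    rw [if_pos (by omega), mul_comm]
  have hGN : ∑ j ∈ Finset.range (max m (s i + 2)), G j = 0 := by
    rw [← hG0]
    refine (Finset.sum_subset (Finset.range_subset_range.2 (le_max_right _ _)) fun j _ hj => ?_).symm
    rw [Finset.mem_range, not_lt] at hj
    simp only [G]
    rw [if_neg (by omega), zero_mul]
  rw [← Finset.sum_range_add_sum_Ico _ (le_max_left m (s i + 2))] at hGN
  have hmem : ∑ j ∈ Finset.range m, G j ∈ idealJ n α k := by
    rw [eq_neg_of_add_eq_zero_left hGN]
    refine neg_mem (Submodule.sum_mem _ fun j hj => ?_)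
    rw [Finset.mem_Ico] at hj
    exact Ideal.mul_mem_left _ _ (Ideal.mul_mem_left _ _ (eSym_mem_idealJ α (by omega)))
  rw [← Fin.sum_univ_eq_sum_range] at hmem
  exact hmem

/-- Cramer's rule: the matrix sends v into J, so det · v has entries in J, and the entry of v at 0
is e_0 = 1. -/
theorem det_flaggedMatrix_mem_idealJ {n r k m : ℕ} (α : Fin r → ℕ) (hm : m + k = n + 1)
    (s : Fin m → Fin n) : (flaggedMatrix s).det ∈ idealJ n α k := by
  rcases Nat.eq_zero_or_pos m with rfl | hpos
  · have h1 := eSym_mem_idealJ (n := n) α (k := k) (d := 0) (by omega)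
    rw [eSym_zero] at h1
    rw [(Ideal.eq_top_iff_one _).2 h1]
    exact Submodule.mem_top
  · set v : Fin m → MvPolynomial (Fin n) ℚ := fun j =>
      (-1) ^ (j : ℕ) * eSym MvPolynomial.X Finset.univ (j : ℕ) with hv
    have h1 : (flaggedMatrix s).adjugate.mulVec ((flaggedMatrix s).mulVec v) =
        (flaggedMatrix s).det • v := by
      rw [Matrix.mulVec_mulVec, Matrix.adjugate_mul, Matrix.smul_mulVec, Matrix.one_mulVec]
    have h2 := congrFun h1 ⟨0, hpos⟩
    have hv0 : v ⟨0, hpos⟩ = 1 := by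
      simp [hv, eSym_zero]
    rw [Pi.smul_apply, hv0, smul_eq_mul, mul_one] at h2
    rw [← h2]
    change ∑ i, (flaggedMatrix s).adjugate ⟨0, hpos⟩ i * (flaggedMatrix s).mulVec v i ∈ _
    exact Submodule.sum_mem _ fun i _ =>
      Ideal.mul_mem_left _ _ (flaggedMatrix_mulVec_mem_idealJ α hm s i)

/-! ### The diagonal term leads the flagged determinant. -/

section FlaggedDegree

variable {n m : ℕ} (s : Fin m ↪o Fin n)

/-- The exponent vector bounding the term of a permutation in the determinant of the flagged
matrix. -/
def flaggedExponents (σ : Equiv.Perm (Fin m)) : Fin n →₀ ℕ :=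
  ∑ i, Finsupp.single (Fin.rev (s (σ i))) ((s (σ i) : ℕ) + 1 - i)

theorem flaggedExponents_apply (σ : Equiv.Perm (Fin m)) (l : Fin m) :
    flaggedExponents s σ (Fin.rev (s l)) = (s l : ℕ) + 1 - (σ.symm l : Fin m) := by
  rw [flaggedExponents, Finsupp.finsetSum_apply, Finset.sum_eq_single (σ.symm l)]
  · rw [Equiv.apply_symm_apply, Finsupp.single_eq_same]
  · intro i _ hi
    refine Finsupp.single_eq_of_ne fun h => hi ?_
    have := s.injective (Fin.rev_injective h)
    rw [this, Equiv.symm_apply_apply]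
  · exact fun h => absurd (Finset.mem_univ _) h

theorem flaggedExponents_apply_of_notMem (σ : Equiv.Perm (Fin m)) {p : Fin n}
    (hp : ∀ l, Fin.rev (s l) ≠ p) : flaggedExponents s σ p = 0 := by
  rw [flaggedExponents, Finsupp.finsetSum_apply]
  exact Finset.sum_eq_zero fun i _ => Finsupp.single_eq_of_ne (hp _).symm

theorem le_orderEmbedding_apply (l : Fin m) : (l : ℕ) ≤ s l := by
  obtain ⟨l, hl⟩ := l
  induction l with
  | zero => exact Nat.zero_le _
  | succ l ih =>
    have h1 := ih (Nat.lt_of_succ_lt hl)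
    have h2 : s ⟨l, Nat.lt_of_succ_lt hl⟩ < s ⟨l + 1, hl⟩ :=
      s.lt_iff_lt.2 (Fin.mk_lt_mk.2 (Nat.lt_succ_self l))
    rw [Fin.lt_def] at h2
    simp only at h1 ⊢
    omega

theorem flaggedExponents_lt {σ : Equiv.Perm (Fin m)} (hσ : σ ≠ 1) :
    flaggedExponents s σ ≺[neglex n] flaggedExponents s 1 := by
  have hne : (Finset.univ.filter fun l => σ.symm l ≠ l).Nonempty := by
    by_contra h
    rw [Finset.not_nonempty_iff_eq_empty, Finset.filter_eq_empty_iff] at h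
    refine hσ (Equiv.ext fun l => ?_)
    have := not_not.1 (h (Finset.mem_univ (σ l)))
    rw [Equiv.symm_apply_apply] at this
    exact this.symm
  let l := (Finset.univ.filter fun l => σ.symm l ≠ l).min' hne
  have hl : σ.symm l ≠ l := (Finset.mem_filter.1 (Finset.min'_mem _ hne)).2
  have hmin : ∀ i < l, σ.symm i = i := fun i hi => by
    by_contra h
    exact absurd (Finset.min'_le _ i (Finset.mem_filter.2 ⟨Finset.mem_univ i, h⟩)) (not_le.2 hi)
  -- All smaller indices are fixed, so the first moved index moves up. This lowers the exponent of
  -- the variable at `Fin.rev (s l)`, the largest variable at which the two vectors differ.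
  have hgt : l < σ.symm l := by
    refine lt_of_le_of_ne (not_lt.1 fun h => ?_) hl.symm
    exact hl (σ.symm.injective (hmin _ h))
  refine (neglex_lt_iff _ _).2 ⟨Fin.rev (s l), ?_, fun p hp => ?_⟩
  · rw [flaggedExponents_apply, flaggedExponents_apply]
    have h1 := le_orderEmbedding_apply s l
    have h2 : (l : ℕ) < (σ.symm l : Fin m) := hgt
    change _ < (s l : ℕ) + 1 - l
    omega
  · by_cases h : ∃ i, Fin.rev (s i) = p
    · obtain ⟨i, rfl⟩ := h
      have hil : i < l := s.lt_iff_lt.1 (Fin.rev_lt_rev.1 hp)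
      rw [flaggedExponents_apply, flaggedExponents_apply, hmin i hil]
      rfl
    · have h' : ∀ i, Fin.rev (s i) ≠ p := fun i hi => h ⟨i, hi⟩
      rw [flaggedExponents_apply_of_notMem s _ h', flaggedExponents_apply_of_notMem s _ h']

theorem degree_flaggedMatrix_term_le (σ : Equiv.Perm (Fin m)) :
    (neglex n).degree (∏ i, flaggedMatrix s (σ i) i) ≼[neglex n] flaggedExponents s σ := by
  refine (neglex n).degree_prod_le.trans ?_
  rw [flaggedExponents, map_sum, map_sum]
  refine Finset.sum_le_sum fun i _ => ?_
  rw [flaggedMatrix, Matrix.of_apply]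
  split_ifs with h
  · rw [(hSym_X_degree (Finset.mem_Iic.2 le_rfl) (fun p hp => Finset.mem_Iic.1 hp) _).1]
  · rw [MonomialOrder.degree_zero, map_zero]
    exact (neglex n).zero_le _

theorem coeff_flaggedMatrix_term_one :
    (∏ i, flaggedMatrix s i i).coeff (flaggedExponents s 1) = 1 := by
  have h : ∀ i, flaggedMatrix s i i =
      hSym MvPolynomial.X (Finset.Iic (Fin.rev (s i))) (s i + 1 - i) := fun i => by
    rw [flaggedMatrix, Matrix.of_apply, if_pos]
    exact (le_orderEmbedding_apply s i).trans (Nat.le_succ _)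
  have hd := fun i : Fin m => hSym_X_degree (Finset.mem_Iic.2 (le_refl (Fin.rev (s i))))
    (fun p hp => Finset.mem_Iic.1 hp) ((s i : ℕ) + 1 - i)
  have : flaggedExponents s 1 = ∑ i, (neglex n).degree (flaggedMatrix s i i) := by
    refine Finset.sum_congr rfl fun i _ => ?_
    rw [h, (hd i).1]
    rfl
  rw [this, MonomialOrder.coeff_prod_sum_degree]
  refine Finset.prod_eq_one fun i _ => ?_
  rw [h]
  exact (hd i).2

theorem degree_det_flaggedMatrix :
    (neglex n).degree (flaggedMatrix s).det = flaggedExponents s 1 ∧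
      (neglex n).Monic (flaggedMatrix s).det := by
  have hle : ∀ σ : Equiv.Perm (Fin m),
      flaggedExponents s σ ≼[neglex n] flaggedExponents s 1 := fun σ => by
    by_cases h : σ = 1
    · rw [h]
    · exact (flaggedExponents_lt s h).le
  rw [Matrix.det_apply]
  refine degree_eq_of_coeff ?_ fun b hb => ?_
  · rw [MvPolynomial.coeff_sum, Finset.sum_eq_single 1]
    · rw [Equiv.Perm.sign_one, one_smul]
      exact coeff_flaggedMatrix_term_one s
    · intro σ _ hσ
      have h0 : (∏ i, flaggedMatrix s (σ i) i).coeff (flaggedExponents s 1) = 0 :=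
        (neglex n).coeff_eq_zero_of_lt
          ((degree_flaggedMatrix_term_le s σ).trans_lt (flaggedExponents_lt s hσ))
      rw [Units.smul_def, MvPolynomial.coeff_smul, h0, smul_zero]
    · exact fun h => absurd (Finset.mem_univ _) h
  · obtain ⟨σ, -, hσ⟩ := Finset.mem_biUnion.1 (MvPolynomial.support_sum hb)
    rw [Units.smul_def] at hσ
    exact ((neglex n).le_degree (MvPolynomial.support_smul hσ)).trans
      ((degree_flaggedMatrix_term_le s σ).trans (hle σ))

end FlaggedDegree

theorem flaggedExponents_one_eq_revSkipMonomial {n m : ℕ} {S : Finset (Fin n)} (hS : S.card = m) :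
    flaggedExponents (S.orderEmbOfFin hS) 1 = revSkipMonomial S := by
  ext p
  change _ = skipSeq S (Fin.rev p)
  rw [skipSeq]
  split_ifs with hp
  · obtain ⟨l, hl⟩ : ∃ l, S.orderEmbOfFin hS l = Fin.rev p := by
      have : Fin.rev p ∈ Set.range (S.orderEmbOfFin hS) := by
        rw [Finset.range_orderEmbOfFin]
        exact hp
      exact this
    have hcard : (S.filter fun q => q ≤ Fin.rev p).card = l + 1 := by
      have : S.filter (fun q => q ≤ Fin.rev p) =
          (Finset.Iic l).map (S.orderEmbOfFin hS).toEmbedding := by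
        ext q
        simp only [Finset.mem_filter, Finset.mem_map, Finset.mem_Iic, RelEmbedding.coe_toEmbedding]
        constructor
        · rintro ⟨hq, hqp⟩
          obtain ⟨i, rfl⟩ : ∃ i, S.orderEmbOfFin hS i = q := by
            have : q ∈ Set.range (S.orderEmbOfFin hS) := by
              rw [Finset.range_orderEmbOfFin]
              exact hq
            exact this
          rw [← hl] at hqp
          exact ⟨i, (S.orderEmbOfFin hS).le_iff_le.1 hqp, rfl⟩
        · rintro ⟨i, hi, rfl⟩
          rw [← hl]
          exact ⟨Finset.orderEmbOfFin_mem _ _ _, (S.orderEmbOfFin hS).le_iff_le.2 hi⟩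
      rw [this, Finset.card_map, Fin.card_Iic]
    have hple := le_orderEmbedding_apply (S.orderEmbOfFin hS) l
    have hpl : p = Fin.rev (S.orderEmbOfFin hS l) := by rw [hl, Fin.rev_rev]
    rw [hcard, hpl, flaggedExponents_apply, Fin.rev_rev]
    change (S.orderEmbOfFin hS l : ℕ) + 1 - l = _
    omega
  · refine flaggedExponents_apply_of_notMem _ _ fun l hl => hp ?_
    rw [← hl, Fin.rev_rev]
    exact Finset.orderEmbOfFin_mem _ _ _

theorem exists_degree_eq_of_notMem_nonskip {n r k : ℕ} {α : Fin r → ℕ} (hα : ∀ i, α i ≤ k)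
    (hn : ∑ i, α i = n) {a : Fin n →₀ ℕ} (ha : a ∉ nonskip n α k) :
    ∃ f ∈ idealJ n α k, f ≠ 0 ∧ (neglex n).degree f = a := by
  rw [nonskip, Set.mem_ofPred_eq, not_and_or] at ha
  push Not at ha
  rcases ha with ⟨S, hS, hle⟩ | ⟨i, j, h1, h2, p, hp, hle⟩
  · have hd := degree_det_flaggedMatrix (S.orderEmbOfFin rfl)
    refine exists_degree_eq_of_degree_le (det_flaggedMatrix_mem_idealJ α hS _) hd.2.ne_zero ?_
    rw [hd.1, flaggedExponents_one_eq_revSkipMonomial]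
    exact hle
  · obtain ⟨f, hf, h0, hd⟩ := exists_degree_eq_single hn (hα i) h1 h2 hp
    refine exists_degree_eq_of_degree_le hf h0 ?_
    rw [hd]
    intro q
    by_cases hq : q = p
    · subst hq
      rwa [Finsupp.single_eq_same]
    · rw [Finsupp.single_eq_of_ne hq]
      exact Nat.zero_le _

/-! ### Standard monomials -/

theorem mem_standardMonomials_iff {n : ℕ} {I : Ideal (MvPolynomial (Fin n) ℚ)} {a : Fin n →₀ ℕ} :
    a ∈ standardMonomials I ↔ ¬ ∃ f ∈ I, f ≠ 0 ∧ (neglex n).degree f = a := by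
  refine not_congr ⟨fun h => ?_, fun ⟨f, hf, h0, hd⟩ => ?_⟩
  · have hspan : initialIdeal I = Ideal.span ((fun s => MvPolynomial.monomial s (1 : ℚ)) ''
        {b | ∃ f ∈ I, f ≠ 0 ∧ (neglex n).degree f = b}) := by
      rw [initialIdeal]
      congr 1
      ext g
      constructor
      · rintro ⟨f, hf, h0, rfl⟩
        exact ⟨_, ⟨f, hf, h0, rfl⟩, rfl⟩
      · rintro ⟨_, ⟨f, hf, h0, rfl⟩, rfl⟩
        exact ⟨f, hf, h0, rfl⟩
    rw [hspan, MvPolynomial.mem_ideal_span_monomial_image] at h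
    obtain ⟨_, ⟨f, hf, h0, rfl⟩, hle⟩ := h a (by
      rw [MvPolynomial.mem_support_iff, MvPolynomial.coeff_monomial, if_pos rfl]
      exact one_ne_zero)
    exact exists_degree_eq_of_degree_le hf h0 hle
  · exact Ideal.subset_span ⟨f, hf, h0, by rw [hd]⟩

/-- Division by well-founded induction on `neglex`: a monomial outside N leads some f in I, so
modulo I it is a combination of smaller monomials. -/
theorem span_monomials_eq_top {n : ℕ} {I : Ideal (MvPolynomial (Fin n) ℚ)} {N : Set (Fin n →₀ ℕ)}
    (hN : ∀ a ∉ N, ∃ f ∈ I, f ≠ 0 ∧ (neglex n).degree f = a) :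
    Submodule.span ℚ (Set.range fun a : N =>
      Ideal.Quotient.mk I (MvPolynomial.monomial (a : Fin n →₀ ℕ) 1)) = ⊤ := by
  set W := Submodule.span ℚ (Set.range fun a : N =>
      Ideal.Quotient.mk I (MvPolynomial.monomial (a : Fin n →₀ ℕ) 1)) with hW
  have hsmul : ∀ (b : Fin n →₀ ℕ) (c : ℚ), Ideal.Quotient.mk I (MvPolynomial.monomial b c) =
      c • Ideal.Quotient.mk I (MvPolynomial.monomial b 1) := fun b c => by
    rw [← Ideal.Quotient.mkₐ_eq_mk ℚ, ← map_smul, MvPolynomial.smul_monomial, smul_eq_mul, mul_one]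
  have hmono : ∀ a, Ideal.Quotient.mk I (MvPolynomial.monomial a 1) ∈ W := by
    intro a
    induction a using (InvImage.wf (neglex n).toSyn wellFounded_lt).induction with
    | _ a ih =>
    by_cases ha : a ∈ N
    · exact Submodule.subset_span ⟨⟨a, ha⟩, rfl⟩
    · obtain ⟨f, hf, h0, hd⟩ := hN a ha
      have hmem : a ∈ f.support := hd ▸ (neglex n).degree_mem_support h0
      have h1 : Ideal.Quotient.mk I f = 0 := Ideal.Quotient.eq_zero_iff_mem.2 hf
      rw [f.as_sum, map_sum, ← Finset.add_sum_erase _ _ hmem, hsmul] at h1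
      have h2 := Submodule.neg_mem W (Submodule.sum_mem W (t := f.support.erase a)
        (f := fun b => Ideal.Quotient.mk I (MvPolynomial.monomial b (f.coeff b))) fun b hb => by
          rw [hsmul]
          refine Submodule.smul_mem _ _ (ih b ?_)
          have hba := (neglex n).le_degree (Finset.mem_of_mem_erase hb)
          rw [hd] at hba
          exact lt_of_le_of_ne hba fun h =>
            Finset.ne_of_mem_erase hb ((neglex n).toSyn.injective h))
      rw [← eq_neg_of_add_eq_zero_left h1] at h2
      exact (Submodule.smul_mem_iff _ (MvPolynomial.mem_support_iff.1 hmem)).1 h2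
  rw [eq_top_iff]
  intro x _
  obtain ⟨f, rfl⟩ := Ideal.Quotient.mk_surjective x
  rw [f.as_sum, map_sum]
  refine Submodule.sum_mem _ fun b _ => ?_
  rw [hsmul]
  exact Submodule.smul_mem _ _ (hmono b)


/-! ### The main results -/

section Main

variable {n r k : ℕ} {α : Fin r → ℕ}

theorem finrank_quotient_idealT {η : Fin k → ℚ} (hη : Function.Injective η) :
    Module.Finite ℚ (MvPolynomial (Fin n) ℚ ⧸ idealT (locus n α η)) ∧
      Module.finrank ℚ (MvPolynomial (Fin n) ℚ ⧸ idealT (locus n α η)) = Nat.card (OP n α k) := by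
  have : Fintype (OP n α k) := Fintype.ofFinite _
  obtain ⟨e, -⟩ := exists_quotient_equiv (OP.point_injective (n := n) (α := α) hη)
  rw [OP.range_point hη] at e
  refine ⟨Module.Finite.equiv e.symm, ?_⟩
  rw [e.finrank_eq, Module.finrank_fintype_fun_eq_card, Nat.card_eq_fintype_card]

theorem finite_nonskip (hk : 0 < k) (hkn : k ≤ n + 1) (hα : ∀ i, 1 ≤ α i ∧ α i ≤ k)
    (hn : ∑ i, α i = n) : Finite (nonskip n α k) := by
  obtain ⟨f, hf⟩ := exists_injective_nonskip hk hkn hα hn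
  exact Finite.of_injective f hf

theorem card_nonskip_le (hk : 0 < k) (hkn : k ≤ n + 1) (hα : ∀ i, 1 ≤ α i ∧ α i ≤ k)
    (hn : ∑ i, α i = n) : Nat.card (nonskip n α k) ≤ Nat.card (OP n α k) := by
  obtain ⟨f, hf⟩ := exists_injective_nonskip hk hkn hα hn
  exact Nat.card_le_card_of_injective f hf

theorem finrank_le_of_degrees {I : Ideal (MvPolynomial (Fin n) ℚ)} {N : Set (Fin n →₀ ℕ)}
    [Finite N] (hN : ∀ a ∉ N, ∃ f ∈ I, f ≠ 0 ∧ (neglex n).degree f = a) :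
    Module.Finite ℚ (MvPolynomial (Fin n) ℚ ⧸ I) ∧
      Module.finrank ℚ (MvPolynomial (Fin n) ℚ ⧸ I) ≤ Nat.card N := by
  have : Fintype N := Fintype.ofFinite _
  have h := span_monomials_eq_top hN
  refine ⟨⟨?_⟩, ?_⟩
  · rw [← h]
    exact Submodule.fg_span (Set.finite_range _)
  · rw [← finrank_top, ← h, Nat.card_eq_fintype_card]
    exact finrank_range_le_card _

/-- The canonical projection between quotients by nested ideals, as a linear map. -/
def quotientProjection {I I' : Ideal (MvPolynomial (Fin n) ℚ)} (h : I ≤ I') :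
    (MvPolynomial (Fin n) ℚ ⧸ I) →ₗ[ℚ] MvPolynomial (Fin n) ℚ ⧸ I' :=
  (Ideal.Quotient.factorₐ ℚ h).toLinearMap

theorem quotientProjection_surjective {I I' : Ideal (MvPolynomial (Fin n) ℚ)} (h : I ≤ I') :
    Function.Surjective (quotientProjection h) := by
  intro x
  obtain ⟨f, rfl⟩ := Ideal.Quotient.mk_surjective x
  exact ⟨Ideal.Quotient.mk I f, rfl⟩

theorem eq_of_finrank_quotient_le {I I' : Ideal (MvPolynomial (Fin n) ℚ)} (h : I ≤ I')
    [Module.Finite ℚ (MvPolynomial (Fin n) ℚ ⧸ I)]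
    (hle : Module.finrank ℚ (MvPolynomial (Fin n) ℚ ⧸ I) ≤
      Module.finrank ℚ (MvPolynomial (Fin n) ℚ ⧸ I')) : I = I' := by
  have hsurj := quotientProjection_surjective h
  have : Module.Finite ℚ (MvPolynomial (Fin n) ℚ ⧸ I') := Module.Finite.of_surjective _ hsurj
  have heq := le_antisymm hle (LinearMap.finrank_le_finrank_of_surjective hsurj)
  have hinj := (LinearMap.injective_iff_surjective_of_finrank_eq_finrank heq).2 hsurj
  refine le_antisymm h fun f hf => ?_
  rw [← Ideal.Quotient.eq_zero_iff_mem] at hf ⊢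
  exact hinj (hf.trans (map_zero _).symm)

theorem idealJ_eq_idealT (hk : 0 < k) (hα : ∀ i, 1 ≤ α i ∧ α i ≤ k) (hn : ∑ i, α i = n)
    {η : Fin k → ℚ} (hη : Function.Injective η) : idealJ n α k = idealT (locus n α η) := by
  have hle := idealJ_le_idealT hn hη
  by_cases hkn : k ≤ n + 1
  · have := finite_nonskip hk hkn hα hn
    obtain ⟨hfin, hrank⟩ := finrank_le_of_degrees (I := idealJ n α k) (N := nonskip n α k)
      fun a ha => exists_degree_eq_of_notMem_nonskip (fun i => (hα i).2) hn ha
    refine eq_of_finrank_quotient_le hle (hrank.trans ((card_nonskip_le hk hkn hα hn).trans ?_))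
    rw [(finrank_quotient_idealT hη).2]
  · have h1 := eSym_mem_idealJ (n := n) α (k := k) (d := 0) (by omega)
    rw [eSym_zero] at h1
    rw [(Ideal.eq_top_iff_one _).2 h1, (Ideal.eq_top_iff_one _).2 (hle h1)]

/-- The distinct rational numbers `0, …, k - 1`. -/
def natPoints (k : ℕ) (j : Fin k) : ℚ :=
  (j : ℕ)

theorem natPoints_injective (k : ℕ) : Function.Injective (natPoints k) :=
  fun _ _ h => Fin.ext (Nat.cast_injective h)

theorem finrank_ringS (hk : 0 < k) (hα : ∀ i, 1 ≤ α i ∧ α i ≤ k) (hn : ∑ i, α i = n) :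
    Module.finrank ℚ (ringS n α k) = Nat.card (OP n α k) := by
  have h := finrank_quotient_idealT (n := n) (α := α) (natPoints_injective k)
  rw [← idealJ_eq_idealT hk hα hn (natPoints_injective k)] at h
  exact h.2

theorem card_nonskip_eq (hk : 0 < k) (hkn : k ≤ n + 1) (hα : ∀ i, 1 ≤ α i ∧ α i ≤ k)
    (hn : ∑ i, α i = n) : Nat.card (nonskip n α k) = Module.finrank ℚ (ringS n α k) := by
  have := finite_nonskip hk hkn hα hn
  refine le_antisymm ?_ (finrank_le_of_degrees (I := idealJ n α k) (N := nonskip n α k)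
      fun a ha => exists_degree_eq_of_notMem_nonskip (fun i => (hα i).2) hn ha).2
  rw [finrank_ringS hk hα hn]
  exact card_nonskip_le hk hkn hα hn

theorem exists_nonskip_basis (hk : 0 < k) (hkn : k ≤ n + 1) (hα : ∀ i, 1 ≤ α i ∧ α i ≤ k)
    (hn : ∑ i, α i = n) :
    ∃ b : Module.Basis (nonskip n α k) ℚ (ringS n α k),
      ∀ a, b a = Ideal.Quotient.mk (idealJ n α k)
        (MvPolynomial.monomial (a : Fin n →₀ ℕ) 1) := by
  have := finite_nonskip hk hkn hα hn
  have : Fintype (nonskip n α k) := Fintype.ofFinite _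
  have h := span_monomials_eq_top (I := idealJ n α k) (N := nonskip n α k)
      fun a ha => exists_degree_eq_of_notMem_nonskip (fun i => (hα i).2) hn ha
  refine ⟨basisOfTopLeSpanOfCardEqFinrank _ h.ge ?_, fun a => ?_⟩
  · rw [← Nat.card_eq_fintype_card]
    exact card_nonskip_eq hk hkn hα hn
  · rw [coe_basisOfTopLeSpanOfCardEqFinrank]

/-- If a nonskip monomial were a leading monomial, the remaining ones would still span the quotient,
with fewer elements than its dimension. -/
theorem standardMonomials_idealJ (hk : 0 < k) (hkn : k ≤ n + 1) (hα : ∀ i, 1 ≤ α i ∧ α i ≤ k)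
    (hn : ∑ i, α i = n) : standardMonomials (idealJ n α k) = nonskip n α k := by
  ext a
  rw [mem_standardMonomials_iff]
  constructor
  · intro h
    by_contra ha
    exact h (exists_degree_eq_of_notMem_nonskip (fun i => (hα i).2) hn ha)
  · intro ha h
    have hfin : (nonskip n α k).Finite := finite_nonskip hk hkn hα hn
    have : Finite (nonskip n α k \ {a} : Set (Fin n →₀ ℕ)) := hfin.subset Set.sdiff_subset
    have hle := (finrank_le_of_degrees (I := idealJ n α k) (N := nonskip n α k \ {a}) fun c hc => by
      by_cases hca : c = a
      · rw [hca]
        exact h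
      · exact exists_degree_eq_of_notMem_nonskip (fun i => (hα i).2) hn
          fun hc' => hc ⟨hc', hca⟩).2
    rw [← card_nonskip_eq hk hkn hα hn, Nat.card_coe_set_eq, Nat.card_coe_set_eq] at hle
    exact absurd (Set.ncard_sdiff_singleton_lt_of_mem ha hfin) (not_lt.2 hle)

theorem rename_mem_harmonics {Z : Set (Fin n → ℚ)} (hZ : idealJ n α k = idealT Z)
    (π : parabolic n α) {h : MvPolynomial (Fin n) ℚ} (hh : h ∈ harmonics Z) :
    MvPolynomial.rename (π : Equiv.Perm (Fin n)) h ∈ harmonics Z := by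
  intro t ht
  have ht' : MvPolynomial.rename ((π⁻¹ : parabolic n α) : Equiv.Perm (Fin n)) t ∈ idealT Z := by
    rw [← hZ] at ht ⊢
    exact idealJ_le_comap α k (π⁻¹ : parabolic n α).2 ht
  rw [← hh _ ht', ← coeffForm_rename (π : Equiv.Perm (Fin n)) h, MvPolynomial.rename_rename]
  congr 1
  have : ((π : Equiv.Perm (Fin n)) ∘ ((π⁻¹ : parabolic n α) : Equiv.Perm (Fin n))) = id := by
    funext p
    exact (π : Equiv.Perm (Fin n)).apply_symm_apply p
  rw [this, MvPolynomial.rename_id_apply]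

theorem evalAt_rename (η : Fin k → ℚ) (π : parabolic n α) (h : MvPolynomial (Fin n) ℚ)
    (σ : OP n α k) :
    evalAt (OP.point η) (MvPolynomial.rename (π : Equiv.Perm (Fin n)) h) σ =
      evalAt (OP.point η) h (π⁻¹ • σ) := by
  change MvPolynomial.aeval _ _ = MvPolynomial.aeval _ _
  rw [MvPolynomial.aeval_rename]
  congr 2
  funext p
  change η (σ.index _) = η ((π⁻¹ • σ).index p)
  rw [← OP.index_smul π (π⁻¹ • σ) p, smul_inv_smul]

theorem nonempty_equiv_repS_repOP (hk : 0 < k) (hα : ∀ i, 1 ≤ α i ∧ α i ≤ k)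
    (hn : ∑ i, α i = n) : Nonempty ((repS n α k).Equiv (repOP n α k)) := by
  have hη := natPoints_injective k
  obtain ⟨e, he⟩ := exists_quotient_equiv (OP.point_injective (n := n) (α := α) hη)
  have hJ : idealJ n α k = idealT (Set.range (OP.point (natPoints k) : OP n α k → _)) := by
    rw [OP.range_point hη]
    exact idealJ_eq_idealT hk hα hn hη
  have hcompl := isCompl_idealT_harmonics (Set.range (OP.point (natPoints k) : OP n α k → _))
  have hrep : ∀ x : ringS n α k, ∃ h ∈ harmonics (Set.range (OP.point (natPoints k) : OP n α k → _)),
      Ideal.Quotient.mk (idealJ n α k) h = x := by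
    intro x
    obtain ⟨f, rfl⟩ := Ideal.Quotient.mk_surjective x
    obtain ⟨t, ht, h, hh, rfl⟩ := Submodule.mem_sup.1
      (hcompl.sup_eq_top ▸ Submodule.mem_top : f ∈ _)
    refine ⟨h, hh, ?_⟩
    have : t ∈ idealJ n α k := hJ ▸ ht
    rw [map_add, Ideal.Quotient.eq_zero_iff_mem.2 this, zero_add]
  -- The ideal is made a variable so that J = T(Z) can be substituted in the type of the quotient.
  have htransfer : ∀ I : Ideal (MvPolynomial (Fin n) ℚ),
      I = idealT (Set.range (OP.point (natPoints k) : OP n α k → _)) →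
      ∃ e' : (MvPolynomial (Fin n) ℚ ⧸ I) ≃ₗ[ℚ] (OP n α k → ℚ),
        ∀ h ∈ harmonics (Set.range (OP.point (natPoints k) : OP n α k → _)),
          e' (Ideal.Quotient.mk I h) = evalAt (OP.point (natPoints k)) h := by
    rintro _ rfl
    exact ⟨e, he⟩
  obtain ⟨e', he'⟩ := htransfer _ hJ
  refine ⟨Representation.Equiv.mk
    ((e'.trans (Finsupp.linearEquivFunOnFinite ℚ ℚ (OP n α k)).symm).trans
      (MonoidAlgebra.coeffLinearEquiv ℚ).symm) fun π => ?_⟩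
  refine LinearMap.ext fun x => ?_
  obtain ⟨h, hh, rfl⟩ := hrep x
  refine MonoidAlgebra.coeff_injective (Finsupp.ext fun σ => ?_)
  rw [LinearMap.comp_apply, LinearMap.comp_apply, Representation.coeff_ofMulAction]
  change e' (Ideal.Quotient.mk _ (MvPolynomial.rename (π : Equiv.Perm (Fin n)) h)) σ =
    e' (Ideal.Quotient.mk _ h) (π⁻¹ • σ)
  rw [he' _ hh, he' _ (rename_mem_harmonics hJ π hh), evalAt_rename]

end Main

end

end SpanningConfig

theorem mainTheorem2 (n r k : ℕ) (hk : 0 < k) (α : Fin r → ℕ)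
    (hα : ∀ i, 1 ≤ α i ∧ α i ≤ k) (hn : ∑ i, α i = n) :
    (k ≤ n + 1 →
      SpanningConfig.standardMonomials (SpanningConfig.idealJ n α k) =
          SpanningConfig.nonskip n α k ∧
      ∃ b : Module.Basis (SpanningConfig.nonskip n α k) ℚ (SpanningConfig.ringS n α k),
        ∀ a, b a = Ideal.Quotient.mk (SpanningConfig.idealJ n α k)
          (MvPolynomial.monomial (a : Fin n →₀ ℕ) 1)) ∧
    Nonempty ((SpanningConfig.repS n α k).Equiv (SpanningConfig.repOP n α k)) ∧
    ∀ η : Fin k → ℚ, Function.Injective η →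
      SpanningConfig.idealJ n α k = SpanningConfig.idealT (SpanningConfig.locus n α η) :=
  ⟨fun hkn => ⟨SpanningConfig.standardMonomials_idealJ hk hkn hα hn,
    SpanningConfig.exists_nonskip_basis hk hkn hα hn⟩,
    SpanningConfig.nonempty_equiv_repS_repOP hk hα hn,
    fun _ hη => SpanningConfig.idealJ_eq_idealT hk hα hn hη⟩
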